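/- **Notation.** Let $$X=\begin{pmatrix}0&1\\1&0\end{pmatrix},\quad Z=\begin{pmatrix}1&0\\0&-1\end{pmatrix},\quad H=\tfrac1{\sqrt2}\begin{pmatrix}1&1\\1&-1\end{pmatrix},\quad CZ=\mathrm{diag}(1,1,1,-1).$$ For $n\ge 0$ the real Pauli group is $\mathcal P_n=\{\pm P_1\otimes\cdots\otimes P_n : P_i\in\{I,X,Z,XZ\}\}$ (so $\mathcal P_0=\{\pm1\}$), and the real Clifford group $\mathcal C_n$ is the normalizer of $\mathcal P_n$ in the orthogonal group $O(2^n)$. Write $U\bullet P=UPU^{-1}$. Circuits on $n$ wires (wire $1$ on top, the first tensor factor) are words in the gates $H$ and $Z$ on single wires and $CZ$ on two adjacent wires. Words are written in the order in which the gates are applied, so the operator of a word is the product of its gates with the first gate as the rightmost factor. For two adjacent wires let $t$, $b$ denote $H$ on the upper and on the lower wire, and $c$ denote $CZ$ on both. The *derived generators* are the following circuits, where the gates of kind $A$, $B$, $C$ have wires carrying a type, single ($s$) or double ($d$), and gates with different names are different even if their circuits agree: * $A_1=$ empty, $A_2=H$ (output type $s$), $A_3=$ empty (output type $d$); * $B_1=B_5=bcbtcbtc$,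 $B_2=B_6=cbtc$, $B_3=B_7=tcbtc$, $B_4=B_8=bcbcbtc$; the type of the lower input wire and the type of the upper output wire are $s\to s$ for $B_1,B_2,B_3$, $s\to d$ for $B_4$, $d\to d$ for $B_5,B_6,B_7$, $d\to s$ for $B_8$; * $C_1=$ empty, $C_2=HZH$ $(=X)$ (input type $s$); * $D_1=cbtcbtcb$, $D_2=tcbtcb$, $D_3=btcbtcb$, $D_4=tcbtcbc$; * $E_1=$ empty, $E_2=Z$. A *$Z$-circuit* on $n\ge1$ wires consists of a gate of kind $A$ on some wire $m\in\{1,\dots,n\}$, followed by gates of kind $B$ on the wires $(m-1,m),(m-2,m-1),\dots,(1,2)$ in this order, followed by a gate of kind $C$ on wire $1$, such that the output type of each gate equals the input type of the next one. An *$X$-circuit* on $n\ge 1$ wires consists of gates of kind $D$ on the wires $(1,2),(2,3),\dots,(n-1,n)$ in this order, followed by a gate of kind $E$ on wire $n$. *Normal circuits* are defined recursively: on $0$ wires they are the scalars $\pm1$; on $n\ge1$ wires they are the circuits $(C'\otimes I)\cdot M\cdot L$ with $L$ a $Z$-circuit and $M$ an $X$-circuit on $n$ wires, and $C'$ a normal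 circuit on the first $n-1$ wires. Thus a normal circuit is given by a scalar $\pm1$ and a choice of derived generators; $-C$ has the same generators as $C$ and the opposite scalar. **Proposition.** Let $n\ge0$. 1. For every group automorphism $\phi$ of $\mathcal P_n$ there is a normal circuit $C$ on $n$ wires such that $C\bullet P=\phi(P)$ for all $P\in\mathcal P_n$. It is unique up to the scalar $\pm1$: a normal circuit $D$ satisfies $D\bullet P=\phi(P)$ for all $P\in\mathcal P_n$ if and only if $D=C$ or $D=-C$ as circuits. 2. Every normal circuit on $n$ wires represents an element of $\mathcal C_n$, and every element of $\mathcal C_n$ is represented by exactly one normal circuit. 3. $\mathcal C_n$ is generated by $-1$, the gates $H$ and $Z$ on single wires, and the gates $CZ$ on pairs of adjacent wires. -/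

import Mathlib

namespace RealClifford

noncomputable section

/-- The orthogonal group `O(2ⁿ)`. Rows and columns are indexed by the computational basis, i.e. by
the bit strings `x : Fin n → Fin 2`, where `x i` is the value of qubit `i` (qubit `0` is the top
wire, the first tensor factor). -/
abbrev Ortho (n : ℕ) : Type := Matrix.orthogonalGroup (Fin n → Fin 2) ℝ

/-- The orthogonal group `O(2)` of a single qubit. -/
abbrev Ortho₂ : Type := Matrix.orthogonalGroup (Fin 2) ℝ

theorem coe_neg_ortho {ι : Type} [Fintype ι] [DecidableEq ι] (U : Matrix.orthogonalGroup ι ℝ) :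
    ((-U : Matrix.orthogonalGroup ι ℝ) : Matrix ι ι ℝ) = -(U : Matrix ι ι ℝ) := rfl

/-- The matrix of `A₀ ⊗ A₁ ⊗ ⋯ ⊗ Aₙ₋₁`. -/
def tensorMatrix {n : ℕ} (A : Fin n → Matrix (Fin 2) (Fin 2) ℝ) :
    Matrix (Fin n → Fin 2) (Fin n → Fin 2) ℝ :=
  Matrix.of fun x y => ∏ i, A i (x i) (y i)

theorem tensorMatrix_mul {n : ℕ} (A B : Fin n → Matrix (Fin 2) (Fin 2) ℝ) :
    tensorMatrix A * tensorMatrix B = tensorMatrix fun i => A i * B i := by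
  ext x y
  simp only [tensorMatrix, Matrix.mul_apply, Matrix.of_apply, ← Finset.prod_mul_distrib]
  rw [Finset.prod_univ_sum, Fintype.piFinset_univ]

theorem tensorMatrix_one {n : ℕ} :
    tensorMatrix (fun _ : Fin n => (1 : Matrix (Fin 2) (Fin 2) ℝ)) = 1 := by
  ext x y
  simp only [tensorMatrix, Matrix.of_apply, Matrix.one_apply, Finset.prod_boole, Finset.mem_univ,
    true_implies, funext_iff]

theorem tensorMatrix_transpose {n : ℕ} (A : Fin n → Matrix (Fin 2) (Fin 2) ℝ) :
    (tensorMatrix A).transpose = tensorMatrix fun i => (A i).transpose := by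
  ext x y
  simp [tensorMatrix, Matrix.transpose_apply]

/-- The tensor product `A₀ ⊗ A₁ ⊗ ⋯ ⊗ Aₙ₋₁` of one-qubit operators. -/
def tensor {n : ℕ} (A : Fin n → Ortho₂) : Ortho n :=
  ⟨tensorMatrix fun i => (A i : Matrix (Fin 2) (Fin 2) ℝ), by
    rw [Matrix.mem_orthogonalGroup_iff, tensorMatrix_transpose, tensorMatrix_mul,
      ← tensorMatrix_one]
    congr 1
    funext i
    exact (Matrix.mem_orthogonalGroup_iff (Fin 2) ℝ).1 (A i).2⟩

theorem tensor_mul {n : ℕ} (A B : Fin n → Ortho₂) :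
    tensor A * tensor B = tensor fun i => A i * B i :=
  Subtype.ext (tensorMatrix_mul _ _)

theorem tensor_one {n : ℕ} : tensor (fun _ : Fin n => (1 : Ortho₂)) = 1 :=
  Subtype.ext tensorMatrix_one

theorem tensor_inv {n : ℕ} (A : Fin n → Ortho₂) : (tensor A)⁻¹ = tensor fun i => (A i)⁻¹ := by
  rw [inv_eq_iff_mul_eq_one, tensor_mul]
  simp [tensor_one]

/-- The Pauli matrix `X`. -/
def pauliX : Ortho₂ :=
  ⟨!![0, 1; 1, 0], by
    rw [Matrix.mem_orthogonalGroup_iff]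
    ext i j
    fin_cases i <;> fin_cases j <;> simp [Matrix.mul_apply]⟩

/-- The Pauli matrix `Z`. -/
def pauliZ : Ortho₂ :=
  ⟨!![1, 0; 0, -1], by
    rw [Matrix.mem_orthogonalGroup_iff]
    ext i j
    fin_cases i <;> fin_cases j <;> simp [Matrix.mul_apply]⟩

/-- The Hadamard matrix `H`. -/
def hadamard : Ortho₂ :=
  ⟨(1 / Real.sqrt 2) • !![1, 1; 1, -1], by
    have h : (Real.sqrt 2)⁻¹ * (Real.sqrt 2)⁻¹ = (1 / 2 : ℝ) := by
      rw [← mul_inv, Real.mul_self_sqrt (by norm_num)]; norm_num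
    rw [Matrix.mem_orthogonalGroup_iff]
    ext i j
    fin_cases i <;> fin_cases j <;> simp [Matrix.mul_apply, h] <;> norm_num⟩

theorem pauliX_mul_self : pauliX * pauliX = 1 := by
  ext i j
  fin_cases i <;> fin_cases j <;> simp [pauliX]

theorem pauliZ_mul_self : pauliZ * pauliZ = 1 := by
  ext i j
  fin_cases i <;> fin_cases j <;> simp [pauliZ]

theorem pauliZ_mul_pauliX : pauliZ * pauliX = -(pauliX * pauliZ) := by
  ext i j
  fin_cases i <;> fin_cases j <;> simp [coe_neg_ortho, pauliX, pauliZ]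

/-- The set `{I, X, Z, XZ}`. -/
def pauliLetters : Set Ortho₂ := {1, pauliX, pauliZ, pauliX * pauliZ}

theorem exists_letter_mul {P Q : Ortho₂} (hP : P ∈ pauliLetters) (hQ : Q ∈ pauliLetters) :
    ∃ R ∈ pauliLetters, P * Q = R ∨ P * Q = -R := by
  have hx := pauliX_mul_self
  have hz := pauliZ_mul_self
  have hzx := pauliZ_mul_pauliX
  have hx' : ∀ A : Ortho₂, pauliX * (pauliX * A) = A := fun A => by rw [← mul_assoc, hx, one_mul]
  have hzx' : ∀ A : Ortho₂, pauliZ * (pauliX * A) = -(pauliX * (pauliZ * A)) := fun A => by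
    rw [← mul_assoc, hzx, neg_mul, mul_assoc]
  rcases hP with rfl | rfl | rfl | rfl <;> rcases hQ with rfl | rfl | rfl | rfl
  all_goals
    simp only [pauliLetters, Set.mem_insert_iff, Set.mem_singleton_iff, exists_eq_or_imp,
      exists_eq_left, one_mul, mul_one, mul_assoc, hx, hz, hzx, hx', hzx', mul_neg]
    simp

theorem exists_letter_inv {P : Ortho₂} (hP : P ∈ pauliLetters) :
    ∃ R ∈ pauliLetters, P⁻¹ = R ∨ P⁻¹ = -R := by
  have hx : pauliX⁻¹ = pauliX := inv_eq_of_mul_eq_one_left pauliX_mul_self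
  have hz : pauliZ⁻¹ = pauliZ := inv_eq_of_mul_eq_one_left pauliZ_mul_self
  rcases hP with rfl | rfl | rfl | rfl
  all_goals
    simp only [pauliLetters, Set.mem_insert_iff, Set.mem_singleton_iff, exists_eq_or_imp,
      exists_eq_left, mul_inv_rev, inv_one, hx, hz, pauliZ_mul_pauliX]
    simp

theorem tensor_eq_or_neg {n : ℕ} (A R : Fin n → Ortho₂) (h : ∀ i, A i = R i ∨ A i = -R i) :
    tensor A = tensor R ∨ tensor A = -tensor R := by
  have key : ∀ x y : Fin n → Fin 2, ∀ s : Finset (Fin n),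
      ∏ i ∈ s, (A i : Matrix (Fin 2) (Fin 2) ℝ) (x i) (y i) =
        (∏ i ∈ s, if A i = R i then (1 : ℝ) else -1) *
          ∏ i ∈ s, (R i : Matrix (Fin 2) (Fin 2) ℝ) (x i) (y i) := by
    intro x y s
    rw [← Finset.prod_mul_distrib]
    refine Finset.prod_congr rfl fun i _ => ?_
    split_ifs with hi
    · rw [hi, one_mul]
    · rw [(h i).resolve_left hi, coe_neg_ortho]
      simp
  have hs : (∏ i, if A i = R i then (1 : ℝ) else -1) = 1 ∨
      (∏ i, if A i = R i then (1 : ℝ) else -1) = -1 := by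
    refine Finset.prod_induction _ (fun r : ℝ => r = 1 ∨ r = -1) ?_ (Or.inl rfl) ?_
    · rintro a b (rfl | rfl) (rfl | rfl) <;> simp
    · intro i _
      split_ifs <;> simp
  rcases hs with hs | hs
  · left
    ext x y
    simp [tensor, tensorMatrix, key x y, hs]
  · right
    ext x y
    simp [coe_neg_ortho, tensor, tensorMatrix, key x y, hs]

/-- The real Pauli group on `n` qubits:
all `±(P₁ ⊗ ⋯ ⊗ Pₙ)` with every `Pᵢ` in `{I, X, Z, XZ}`. -/
def pauliGroup (n : ℕ) : Subgroup (Ortho n) where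
  carrier := {U | ∃ P : Fin n → Ortho₂, (∀ i, P i ∈ pauliLetters) ∧
    (U = tensor P ∨ U = -tensor P)}
  one_mem' := ⟨fun _ => 1, fun _ => Or.inl rfl, Or.inl tensor_one.symm⟩
  mul_mem' := by
    rintro U V ⟨P, hP, hU⟩ ⟨Q, hQ, hV⟩
    choose R hR hPQ using fun i => exists_letter_mul (hP i) (hQ i)
    refine ⟨R, hR, ?_⟩
    have h := tensor_eq_or_neg (fun i => P i * Q i) R hPQ
    rw [← tensor_mul] at h
    rcases hU with rfl | rfl <;> rcases hV with rfl | rfl <;> rcases h with h | h <;> simp [h]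
  inv_mem' := by
    rintro U ⟨P, hP, hU⟩
    choose R hR hPR using fun i => exists_letter_inv (hP i)
    refine ⟨R, hR, ?_⟩
    have h := tensor_eq_or_neg (fun i => (P i)⁻¹) R hPR
    rw [← tensor_inv] at h
    have hn : ∀ V : Ortho n, (-V)⁻¹ = -V⁻¹ := fun V => by
      rw [inv_eq_iff_mul_eq_one]; simp
    rcases hU with rfl | rfl <;> rcases h with h | h <;> simp [h, hn]

/-- The real Clifford group on `n` qubits: the normalizer of the real Pauli group in `O(2ⁿ)`. -/
def cliffordGroup (n : ℕ) : Subgroup (Ortho n) :=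
  Subgroup.normalizer (pauliGroup n : Set (Ortho n))

/-! ### Circuits over `H`, `Z` and `CZ` -/

/-- The gate `I ⊗ ⋯ ⊗ I ⊗ G ⊗ I ⊗ ⋯ ⊗ I` with `G` on wire `i`. -/
def onWire {n : ℕ} (i : Fin n) (G : Ortho₂) : Ortho n :=
  tensor (Function.update (fun _ => 1) i G)

/-- The gate `I ⊗ ⋯ ⊗ I ⊗ CZ ⊗ I ⊗ ⋯ ⊗ I` on the wires `i` and `j`: the diagonal operator that
flips the sign of exactly those basis vectors in which the qubits `i` and `j` are both `1`. -/
def controlledZ {n : ℕ} (i j : Fin n) : Ortho n :=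
  ⟨Matrix.diagonal fun x => if x i = 1 ∧ x j = 1 then -1 else 1, by
    rw [Matrix.mem_orthogonalGroup_iff, Matrix.diagonal_transpose, Matrix.diagonal_mul_diagonal,
      ← Matrix.diagonal_one]
    congr 1
    funext x
    split_ifs <;> simp⟩

/-- The elementary gates on `n` wires; `CZ i` acts on the adjacent wires `i` and `i + 1`. -/
inductive Gate (n : ℕ) : Type
  | H (i : Fin n) : Gate n
  | Z (i : Fin n) : Gate n
  | CZ (i : ℕ) (h : i + 1 < n) : Gate n

/-- The operator of an elementary gate. -/
def Gate.op {n : ℕ} : Gate n → Ortho n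
  | .H i => onWire i hadamard
  | .Z i => onWire i pauliZ
  | .CZ i h => controlledZ ⟨i, by omega⟩ ⟨i + 1, h⟩

/-- The same gate, on the first `n` of `n + 1` wires. -/
def Gate.castSucc {n : ℕ} : Gate n → Gate (n + 1)
  | .H i => .H i.castSucc
  | .Z i => .Z i.castSucc
  | .CZ i h => .CZ i (by omega)

/-- A circuit, read from left to right: the head of the list is applied first. -/
abbrev Circuit (n : ℕ) : Type := List (Gate n)

/-- The operator of a circuit. The gate applied first is the rightmost factor. -/
def Circuit.op {n : ℕ} : Circuit n → Ortho n
  | [] => 1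
  | g :: w => Circuit.op w * g.op

/-! ### Typed derived generators -/

/-- The two distinguished types of wires, which restrict how the derived generators may be composed.
The remaining wires of the derived generators impose no restriction and carry no type. -/
inductive WireType : Type
  | single
  | double

open WireType

/-- Derived generators of kind `A`, indexed by the type of the output wire. -/
inductive GateA : WireType → Type
  | A1 : GateA single
  | A2 : GateA single
  | A3 : GateA double

/-- Derived generators of kind `B`, indexed by the type of the bottom input wire and the type of
the top output wire. -/
inductive GateB : WireType → WireType → Type
  | B1 : GateB single single
  | B2 : GateB single single
  | B3 : GateB single single
  | B4 : GateB single double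
  | B5 : GateB double double
  | B6 : GateB double double
  | B7 : GateB double double
  | B8 : GateB double single

/-- Derived generators of kind `C`; their input wire is of single type. -/
inductive GateC : Type
  | C1
  | C2

/-- Derived generators of kind `D`. -/
inductive GateD : Type
  | D1
  | D2
  | D3
  | D4

/-- Derived generators of kind `E`. -/
inductive GateE : Type
  | E1
  | E2

/-- The circuit of an `A` gate on wire `i`. -/
def GateA.circuit {n : ℕ} {t : WireType} (i : Fin n) : GateA t → Circuit n
  | .A1 => []
  | .A2 => [.H i]
  | .A3 => []

/-- The circuit of a `B` gate on the wires `i` (top) and `i + 1` (bottom). -/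
def GateB.circuit {n : ℕ} {t u : WireType} (i : ℕ) (h : i + 1 < n) (b : GateB t u) : Circuit n :=
  let top : Fin n := ⟨i, by omega⟩
  let bot : Fin n := ⟨i + 1, h⟩
  match b with
  | .B1 | .B5 => [.H bot, .CZ i h, .H bot, .H top, .CZ i h, .H bot, .H top, .CZ i h]
  | .B2 | .B6 => [.CZ i h, .H bot, .H top, .CZ i h]
  | .B3 | .B7 => [.H top, .CZ i h, .H bot, .H top, .CZ i h]
  | .B4 | .B8 => [.H bot, .CZ i h, .H bot, .CZ i h, .H bot, .H top, .CZ i h]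

/-- The circuit of a `C` gate on wire `i`: nothing, or the gate `X = HZH`. -/
def GateC.circuit {n : ℕ} (i : Fin n) : GateC → Circuit n
  | .C1 => []
  | .C2 => [.H i, .Z i, .H i]

/-- The circuit of a `D` gate on the wires `i` (top) and `i + 1` (bottom). -/
def GateD.circuit {n : ℕ} (i : ℕ) (h : i + 1 < n) (d : GateD) : Circuit n :=
  let top : Fin n := ⟨i, by omega⟩
  let bot : Fin n := ⟨i + 1, h⟩
  match d with
  | .D1 => [.CZ i h, .H bot, .H top, .CZ i h, .H bot, .H top, .CZ i h, .H bot]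
  | .D2 => [.H top, .CZ i h, .H bot, .H top, .CZ i h, .H bot]
  | .D3 => [.H bot, .H top, .CZ i h, .H bot, .H top, .CZ i h, .H bot]
  | .D4 => [.H top, .CZ i h, .H bot, .H top, .CZ i h, .H bot, .CZ i h]

/-- The circuit of an `E` gate on wire `i`. -/
def GateE.circuit {n : ℕ} (i : Fin n) : GateE → Circuit n
  | .E1 => []
  | .E2 => [.Z i]

/-! ### Normal circuits -/

/-- A well-typed ladder of `B` gates that starts on wire `k`, entering with type `t`, climbs wire
by wire to wire `0`, and leaves wire `0` with single type. -/
inductive BLadder : ℕ → WireType → Type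
  | nil : BLadder 0 single
  | cons {k : ℕ} {t u : WireType} (b : GateB t u) (l : BLadder k u) : BLadder (k + 1) t

/-- The circuit of a ladder of `B` gates on `n` wires. -/
def BLadder.circuit (n : ℕ) : {k : ℕ} → {t : WireType} → BLadder k t → k < n → Circuit n
  | _, _, .nil, _ => []
  | _, _, .cons (k := k) b l, h => b.circuit k h ++ l.circuit n (by omega)

/-- A `Z`-circuit on `n + 1` qubits: an `A` gate on some wire `m`, a ladder of `B` gates from wire
`m` up to the top wire, and a `C` gate on the top wire. -/
structure ZCircuit (n : ℕ) : Type where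
  m : Fin (n + 1)
  t : WireType
  a : GateA t
  ladder : BLadder m t
  c : GateC

/-- The underlying circuit of a `Z`-circuit. -/
def ZCircuit.circuit {n : ℕ} (L : ZCircuit n) : Circuit (n + 1) :=
  L.a.circuit L.m ++ L.ladder.circuit (n + 1) L.m.isLt ++ L.c.circuit 0

/-- An `X`-circuit on `n + 1` qubits: `D` gates on the wires `(0, 1), (1, 2), …, (n - 1, n)`, in
this order, and an `E` gate on the bottom wire `n`. -/
structure XCircuit (n : ℕ) : Type where
  d : Fin n → GateD
  e : GateE

/-- The underlying circuit of an `X`-circuit. -/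
def XCircuit.circuit {n : ℕ} (M : XCircuit n) : Circuit (n + 1) :=
  (List.finRange n).flatMap (fun i => (M.d i).circuit i.val (by omega)) ++
    M.e.circuit (Fin.last n)

/-- A normal circuit without its scalar. On `n + 1` qubits it is `(C' ⊗ I) · M · L`, with `L` a
`Z`-circuit, `M` an `X`-circuit, and `C'` such a circuit on the first `n` qubits. -/
inductive NormalBody : ℕ → Type
  | nil : NormalBody 0
  | step {n : ℕ} (C' : NormalBody n) (M : XCircuit n) (L : ZCircuit n) : NormalBody (n + 1)

/-- The underlying circuit: first `L`, then `M`, then `C'` on the first `n` wires. -/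
def NormalBody.circuit : {n : ℕ} → NormalBody n → Circuit n
  | _, .nil => []
  | _, .step C' M L => L.circuit ++ M.circuit ++ C'.circuit.map Gate.castSucc

/-- A normal circuit on `n` qubits: a body, together with a scalar `±1`, which is `-1` if
`negative` is true. -/
@[ext]
structure NormalCircuit (n : ℕ) : Type where
  negative : Bool
  body : NormalBody n

/-- The operator of a normal circuit. -/
def NormalCircuit.op {n : ℕ} (C : NormalCircuit n) : Ortho n :=
  if C.negative then -C.body.circuit.op else C.body.circuit.op

/-- The normal circuit `(-1) · C`: the same gates with the opposite scalar. -/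
instance (n : ℕ) : Neg (NormalCircuit n) := ⟨fun C => ⟨!C.negative, C.body⟩⟩

/-- `C • P = φ(P)` for every Pauli operator `P`, where `C • P = C P C⁻¹`. -/
def NormalCircuit.Realizes {n : ℕ} (C : NormalCircuit n) (φ : pauliGroup n ≃* pauliGroup n) :
    Prop :=
  ∀ P : pauliGroup n, C.op * (P : Ortho n) * C.op⁻¹ = (φ P : Ortho n)

end

end RealClifford

namespace RealClifford

noncomputable section

open scoped Fin.CommRing

open WireType

/-! Everything is reduced to the symbolic Pauli group: a sign bit and, on each wire, exponents `(x,
z)` of `X ^ x * Z ^ z`. The map `op` to operators is faithful, and each gate conjugates symbols by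
an explicit rule, so the action of a derived generator on its two wires is a function on 32 states
that can be checked exhaustively.

The core is `existsUnique_normalBody`, by induction on the number of wires. For an automorphism `φ`,
let `a` and `b` be the preimages of `Z` and `X` on the last wire; they square to `1` and
anticommute. Exactly one `Z`-circuit `L` sends `a` to `Z` on the top wire (`existsUnique_zCircuit`):
the `A` gate sits at the bottommost nontrivial letter, each `B` gate is dictated by the letter above
it and the incoming type, and `C` corrects the sign. The type records whether the moving letter is
`Z` or `XZ`; since `a * a = 1` the number of letters `XZ` is even, so the ladder can leave with
single type.

The image of `b` under `L` now anticommutes with `Z` on the top wire, and exactly one `X`-circuit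
`M` sends it to `X` on the last wire (`existsUnique_xCircuit`). Every `X`-circuit moves `Z` from the
top wire to the last (`XCircuit.act_wordZ`), so `M` and `L` together account for both `a` and `b`.
What remains of `φ` fixes `X` and `Z` on the last wire, hence preserves their common centralizer,
the Pauli group of the first `n` wires, and induction applies. Conversely `C' ⊗ I` fixes these two
operators, so any normal circuit for `φ` must contain this `L` and this `M`.

Passing to operators costs only a sign: an orthogonal matrix commuting with all Paulis is `±1`
(`eq_one_or_eq_neg_one_of_commute`), so a Clifford operator is determined up to sign by its
conjugation action, and the scalar of the normal circuit settles the sign. Generation by the gates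
is then immediate. -/

theorem fin_two_add_self : ∀ s : Fin 2, s + s = 0 := by decide

/-! ### Signs -/

/-- The real number `(-1) ^ s`. -/
def realSign (s : Fin 2) : ℝ := if s = 0 then 1 else -1

theorem realSign_zero : realSign 0 = 1 := rfl

theorem realSign_one : realSign 1 = -1 := by simp [realSign]

theorem realSign_add (s t : Fin 2) : realSign (s + t) = realSign s * realSign t := by
  have h : ∀ s : Fin 2, s = 0 ∨ s = 1 := by decide
  rcases h s with rfl | rfl <;> rcases h t with rfl | rfl <;>
    simp [realSign_zero, realSign_one, show (1 + 1 : Fin 2) = 0 from rfl]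

theorem realSign_mul_self (s : Fin 2) : realSign s * realSign s = 1 := by
  rw [← realSign_add, fin_two_add_self, realSign_zero]

theorem realSign_ne_zero (s : Fin 2) : realSign s ≠ 0 := by
  intro h
  simpa [h] using realSign_mul_self s

theorem realSign_injective : Function.Injective realSign := by
  have h : ∀ s : Fin 2, s = 0 ∨ s = 1 := by decide
  intro s t hst
  rcases h s with rfl | rfl <;> rcases h t with rfl | rfl <;>
    first | rfl | (norm_num [realSign_zero, realSign_one] at hst)

theorem realSign_sum {ι : Type*} (I : Finset ι) (f : ι → Fin 2) :
    realSign (∑ i ∈ I, f i) = ∏ i ∈ I, realSign (f i) := by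
  classical
  induction I using Finset.induction_on with
  | empty => simp [realSign_zero]
  | insert a I ha ih => rw [Finset.sum_insert ha, Finset.prod_insert ha, realSign_add, ih]

/-! ### Symbolic Pauli operators -/

/-- The pair `(x, z)` stands for the one-qubit operator `X ^ x * Z ^ z`. -/
abbrev Letter : Type := Fin 2 × Fin 2

/-- The operator `X ^ x * Z ^ z`. -/
def Letter.op (a : Letter) : Ortho₂ :=
  (if a.1 = 0 then 1 else pauliX) * (if a.2 = 0 then 1 else pauliZ)

theorem Letter.op_apply (a : Letter) (x y : Fin 2) :
    (Letter.op a : Matrix (Fin 2) (Fin 2) ℝ) x y =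
      if x = y + a.1 then realSign (a.2 * y) else 0 := by
  obtain ⟨a, b⟩ := a
  have h : ∀ s : Fin 2, s = 0 ∨ s = 1 := by decide
  have h11 : (1 : Fin 2) + 1 = 0 := by decide
  rcases h a with rfl | rfl <;> rcases h b with rfl | rfl <;> rcases h x with rfl | rfl <;>
    rcases h y with rfl | rfl <;>
    simp [Letter.op, realSign, pauliX, pauliZ, h11]

theorem Letter.op_mem (a : Letter) : a.op ∈ pauliLetters := by
  simp only [Letter.op, pauliLetters, Set.mem_insert_iff, Set.mem_singleton_iff]
  split_ifs <;> simp

theorem exists_letter_op {P : Ortho₂} (hP : P ∈ pauliLetters) : ∃ a : Letter, a.op = P := by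
  rcases hP with rfl | rfl | rfl | rfl
  · exact ⟨(0, 0), by simp [Letter.op]⟩
  · exact ⟨(1, 0), by simp [Letter.op]⟩
  · exact ⟨(0, 1), by simp [Letter.op]⟩
  · exact ⟨(1, 1), by simp [Letter.op]⟩

/-- A symbolic Pauli operator `(-1) ^ s • ⊗ᵢ X ^ xᵢ * Z ^ zᵢ` with `v i = (xᵢ, zᵢ)`. -/
@[ext]
structure PauliWord (n : ℕ) : Type where
  s : Fin 2
  v : Fin n → Letter

namespace PauliWord

variable {n : ℕ}

instance : One (PauliWord n) := ⟨⟨0, 0⟩⟩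

/-- The sum collects the signs from moving each `Z` of `p` past each `X` of `q` on the same wire. -/
instance : Mul (PauliWord n) := ⟨fun p q =>
  ⟨p.s + q.s + ∑ i, (p.v i).2 * (q.v i).1, p.v + q.v⟩⟩

instance : Neg (PauliWord n) := ⟨fun p => ⟨p.s + 1, p.v⟩⟩

theorem one_s : (1 : PauliWord n).s = 0 := rfl

theorem one_v : (1 : PauliWord n).v = 0 := rfl

theorem mul_s (p q : PauliWord n) :
    (p * q).s = p.s + q.s + ∑ i, (p.v i).2 * (q.v i).1 := rfl

theorem mul_v (p q : PauliWord n) : (p * q).v = p.v + q.v := rfl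

theorem neg_s (p : PauliWord n) : (-p).s = p.s + 1 := rfl

theorem neg_v (p : PauliWord n) : (-p).v = p.v := rfl

/-- Unit laws suffice: identities needing associativity are proved for operators and pulled back
along the injective `op`. -/
instance : MulOneClass (PauliWord n) where
  one_mul p := by ext <;> simp [mul_s, mul_v, one_s, one_v]
  mul_one p := by ext <;> simp [mul_s, mul_v, one_s, one_v]

/-- The operator `(-1) ^ s • ⊗ᵢ X ^ xᵢ * Z ^ zᵢ`. -/
def op (p : PauliWord n) : Ortho n :=
  if p.s = 0 then tensor fun i => (p.v i).op else -tensor fun i => (p.v i).op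

theorem op_coe (p : PauliWord n) :
    (p.op : Matrix (Fin n → Fin 2) (Fin n → Fin 2) ℝ) =
      realSign p.s • (tensor fun i => (p.v i).op : Ortho n).1 := by
  unfold op realSign
  split_ifs
  · simp
  · rw [coe_neg_ortho]; simp

/-- A Pauli operator is a signed permutation matrix: it shifts basis vectors by the `x` bits, with a
sign that is affine in the column index. -/
theorem op_apply (p : PauliWord n) (x y : Fin n → Fin 2) :
    (p.op : Matrix (Fin n → Fin 2) (Fin n → Fin 2) ℝ) x y =
      if x = (fun i => y i + (p.v i).1) then realSign (p.s + ∑ i, (p.v i).2 * y i) else 0 := by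
  rw [op_coe, Matrix.smul_apply, smul_eq_mul, realSign_add, realSign_sum]
  simp only [tensor, tensorMatrix, Matrix.of_apply]
  rw [Finset.prod_congr rfl fun i _ => Letter.op_apply (p.v i) (x i) (y i)]
  rw [Finset.prod_ite_zero]
  simp [funext_iff]

theorem op_one : op (1 : PauliWord n) = 1 := by
  have : ∀ i, ((1 : PauliWord n).v i).op = 1 := by simp [one_v, Letter.op]
  rw [op, if_pos one_s]
  simp only [this, tensor_one]

theorem op_mul (p q : PauliWord n) : (p * q).op = p.op * q.op := by
  apply Subtype.ext
  ext x y
  rw [Submonoid.coe_mul, Matrix.mul_apply, op_apply]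
  change _ = ∑ w : Fin n → Fin 2, _
  simp only [op_apply]
  -- Only one intermediate basis vector contributes, namely `y` shifted by `q`; evaluating the sign
  -- of `p` there yields the extra sum in `mul_s`.
  rw [Finset.sum_eq_single (fun i => y i + (q.v i).1)]
  · rw [if_pos rfl]
    have h : x = (fun i => y i + ((p * q).v i).1) ↔
        x = fun i => y i + (q.v i).1 + (p.v i).1 := by
      have : (fun i => y i + ((p * q).v i).1) = fun i => y i + (q.v i).1 + (p.v i).1 := by
        funext i
        simp only [mul_v, Pi.add_apply, Prod.fst_add]
        ring
      rw [this]
    simp only [h, ite_mul, zero_mul]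
    congr 1
    rw [← realSign_add]
    congr 1
    simp only [mul_s, mul_v, Pi.add_apply, Prod.snd_add, mul_add, add_mul, Finset.sum_add_distrib]
    ring
  · intro w _ hw
    rw [if_neg hw, mul_zero]
  · simp

theorem op_neg (p : PauliWord n) : (-p).op = -p.op := by
  apply Subtype.ext
  rw [coe_neg_ortho, op_coe, op_coe, neg_s, neg_v, realSign_add, realSign_one]
  simp

theorem op_injective : Function.Injective (op : PauliWord n → Ortho n) := by
  intro p q h
  have key : ∀ x y : Fin n → Fin 2,
      (if x = (fun i => y i + (p.v i).1) then realSign (p.s + ∑ i, (p.v i).2 * y i) else 0) =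
        if x = (fun i => y i + (q.v i).1) then realSign (q.s + ∑ i, (q.v i).2 * y i) else 0 := by
    intro x y
    rw [← op_apply, ← op_apply, h]
  -- The position of the nonzero entry in column `0` reveals the `x` bits. The signs over all
  -- columns then give the rest: column `0` the sign bit, unit vectors the `z` bits.
  have hx : ∀ i, (p.v i).1 = (q.v i).1 := by
    have := key (fun i => 0 + (p.v i).1) 0
    rw [if_pos (by rfl)] at this
    split_ifs at this with h1
    · intro i
      simpa using congrFun h1 i
    · exact absurd this (realSign_ne_zero _)
  have key' : ∀ y : Fin n → Fin 2,
      p.s + ∑ i, (p.v i).2 * y i = q.s + ∑ i, (q.v i).2 * y i := by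
    intro y
    have := key (fun i => y i + (p.v i).1) y
    rw [if_pos rfl, if_pos (by simp only [hx])] at this
    exact realSign_injective this
  have hs : p.s = q.s := by simpa using key' 0
  refine PauliWord.ext hs (funext fun i => Prod.ext (hx i) ?_)
  simpa [hs, Pi.single_apply] using key' (Pi.single i 1)

theorem op_mem (p : PauliWord n) : p.op ∈ pauliGroup n := by
  refine ⟨fun i => (p.v i).op, fun i => Letter.op_mem _, ?_⟩
  unfold op
  split_ifs <;> simp

theorem exists_op_eq {U : Ortho n} (hU : U ∈ pauliGroup n) : ∃ p : PauliWord n, p.op = U := by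
  obtain ⟨P, hP, hU⟩ := hU
  choose a ha using fun i => exists_letter_op (hP i)
  obtain rfl : (fun i => (a i).op) = P := funext ha
  rcases hU with rfl | rfl
  · exact ⟨⟨0, a⟩, by simp [op]⟩
  · exact ⟨⟨1, a⟩, by simp [op]⟩

/-- Symbolic Pauli operators are Pauli operators. -/
def opEquiv (n : ℕ) : PauliWord n ≃* pauliGroup n :=
  MulEquiv.ofBijective
    ({ toFun := fun p => ⟨p.op, p.op_mem⟩
       map_mul' := fun p q => Subtype.ext (op_mul p q) } : PauliWord n →ₙ* pauliGroup n)
    ⟨fun p q h => op_injective (congrArg Subtype.val h), fun U => by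
      obtain ⟨p, hp⟩ := exists_op_eq U.2
      exact ⟨p, Subtype.ext hp⟩⟩

theorem coe_opEquiv (p : PauliWord n) : (opEquiv n p : Ortho n) = p.op := rfl

/-- An operator that commutes with all Pauli operators is a scalar. -/
theorem eq_one_or_eq_neg_one_of_commute (U : Ortho n) (h : ∀ p : PauliWord n, U * p.op = p.op * U) :
    U = 1 ∨ U = -1 := by
  set M : Matrix (Fin n → Fin 2) (Fin n → Fin 2) ℝ := U.1
  have key : ∀ (p : PauliWord n) (x y : Fin n → Fin 2),
      M x (fun i => y i + (p.v i).1) * realSign (p.s + ∑ i, (p.v i).2 * y i) =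
        realSign (p.s + ∑ i, (p.v i).2 * (x i + (p.v i).1)) * M (fun i => x i + (p.v i).1) y := by
    intro p x y
    have h1 := congrFun (congrFun (congrArg Subtype.val (h p)) x) y
    simp only [Submonoid.coe_mul, Matrix.mul_apply] at h1
    change (∑ w : Fin n → Fin 2, M x w * p.op.1 w y) =
      ∑ w : Fin n → Fin 2, p.op.1 x w * M w y at h1
    simp only [op_apply] at h1
    rw [Finset.sum_eq_single (fun i => y i + (p.v i).1),
      Finset.sum_eq_single (fun i => x i + (p.v i).1)] at h1
    · rw [if_pos rfl, if_pos (by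
        funext i; rw [add_assoc, fin_two_add_self, add_zero])] at h1
      exact h1
    · intro w _ hw
      rw [if_neg, zero_mul]
      rintro rfl
      apply hw
      funext i
      rw [add_assoc, fin_two_add_self, add_zero]
    · simp
    · intro w _ hw
      rw [if_neg hw, mul_zero]
    · simp
  -- Commuting with `Z` on a wire where `x` and `y` differ kills the entry.
  have hoff : ∀ x y : Fin n → Fin 2, x ≠ y → M x y = 0 := by
    intro x y hxy
    obtain ⟨i, hi⟩ := Function.ne_iff.1 hxy
    have h1 := key ⟨0, Pi.single i (0, 1)⟩ x y
    have e1 : ∀ j, ((Pi.single i (0, 1) : Fin n → Letter) j).1 = 0 := by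
      intro j
      by_cases hj : j = i
      · subst hj; simp
      · simp [hj]
    have e2 : ∀ w : Fin n → Fin 2,
        ∑ j, ((Pi.single i (0, 1) : Fin n → Letter) j).2 * w j = w i := by
      intro w
      rw [Finset.sum_eq_single i]
      · simp
      · intro j _ hj
        simp [hj]
      · simp
    simp only [e1, e2, add_zero, zero_add] at h1
    by_contra h0
    rw [mul_comm] at h1
    exact hi (realSign_injective (mul_right_cancel₀ h0 h1)).symm
  -- Commuting with the product of `X` over the ones of `x`, read at entry `(x, 0)`, makes the
  -- diagonal constant.
  have hdiag : ∀ x : Fin n → Fin 2, M x x = M 0 0 := by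
    intro x
    have h1 := key ⟨0, fun i => (x i, 0)⟩ x 0
    have e : (fun i => x i + x i) = (0 : Fin n → Fin 2) := by
      funext i
      exact fin_two_add_self _
    simpa [realSign_zero, e] using h1
  have hsq : M 0 0 * M 0 0 = 1 := by
    have h1 := congrFun (congrFun ((Matrix.mem_orthogonalGroup_iff _ ℝ).1 U.2)
      (0 : Fin n → Fin 2)) (0 : Fin n → Fin 2)
    rw [Matrix.mul_apply, Matrix.one_apply_eq] at h1
    change (∑ w : Fin n → Fin 2, M 0 w * M 0 w) = 1 at h1
    rwa [Finset.sum_eq_single (0 : Fin n → Fin 2)] at h1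
    · intro w _ hw
      rw [hoff _ _ hw.symm, mul_zero]
    · simp
  rcases mul_self_eq_one_iff.1 hsq with h1 | h1
  · left
    apply Subtype.ext
    change M = (1 : Matrix (Fin n → Fin 2) (Fin n → Fin 2) ℝ)
    ext x y
    by_cases hxy : x = y
    · rw [hxy, hdiag, h1, Matrix.one_apply_eq]
    · rw [hoff _ _ hxy, Matrix.one_apply_ne hxy]
  · right
    apply Subtype.ext
    change M = -(1 : Matrix (Fin n → Fin 2) (Fin n → Fin 2) ℝ)
    ext x y
    by_cases hxy : x = y
    · rw [hxy, hdiag, h1, Matrix.neg_apply, Matrix.one_apply_eq]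
    · rw [hoff _ _ hxy, Matrix.neg_apply, Matrix.one_apply_ne hxy, neg_zero]

end PauliWord

/-! ### The symbolic action of gates -/

/-- Conjugation by a gate, on symbolic Pauli operators. -/
def Gate.act {n : ℕ} : Gate n → PauliWord n → PauliWord n
  | .H i, p => ⟨p.s + (p.v i).1 * (p.v i).2, Function.update p.v i (p.v i).swap⟩
  | .Z i, p => ⟨p.s + (p.v i).1, p.v⟩
  | .CZ i h, p =>
    ⟨p.s + (p.v ⟨i, by omega⟩).1 * (p.v ⟨i + 1, h⟩).1,
      Function.update
        (Function.update p.v ⟨i, by omega⟩ (p.v ⟨i, by omega⟩ + (0, (p.v ⟨i + 1, h⟩).1)))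
        ⟨i + 1, h⟩ (p.v ⟨i + 1, h⟩ + (0, (p.v ⟨i, by omega⟩).1))⟩

/-- `H` exchanges `X` and `Z`; restoring the order `X` before `Z` costs the sign exactly for `XZ`.
-/
theorem hadamard_mul_letter (a : Letter) (x y : Fin 2) :
    (hadamard * a.op : Ortho₂).1 x y =
      realSign (a.1 * a.2) * (Letter.op a.swap * hadamard : Ortho₂).1 x y := by
  have h : ∀ s : Fin 2, s = 0 ∨ s = 1 := by decide
  obtain ⟨a, b⟩ := a
  rcases h a with rfl | rfl <;> rcases h b with rfl | rfl <;> fin_cases x <;> fin_cases y <;>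
    simp [Letter.op, realSign, pauliX, pauliZ, hadamard]

theorem pauliZ_mul_letter (a : Letter) (x y : Fin 2) :
    (pauliZ * a.op : Ortho₂).1 x y = realSign a.1 * (a.op * pauliZ : Ortho₂).1 x y := by
  have h : ∀ s : Fin 2, s = 0 ∨ s = 1 := by decide
  obtain ⟨a, b⟩ := a
  rcases h a with rfl | rfl <;> rcases h b with rfl | rfl <;> fin_cases x <;> fin_cases y <;>
    simp [Letter.op, realSign, pauliX, pauliZ]

theorem onWire_mul_op {n : ℕ} (i : Fin n) (G : Ortho₂) (p : PauliWord n) (t : Fin 2) (b : Letter)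
    (h : ∀ x y, (G * (p.v i).op : Ortho₂).1 x y = realSign t * (b.op * G : Ortho₂).1 x y) :
    onWire i G * p.op = PauliWord.op ⟨p.s + t, Function.update p.v i b⟩ * onWire i G := by
  apply Subtype.ext
  rw [Submonoid.coe_mul, Submonoid.coe_mul, PauliWord.op_coe, PauliWord.op_coe, Matrix.mul_smul,
    Matrix.smul_mul, ← Submonoid.coe_mul, ← Submonoid.coe_mul, onWire, tensor_mul, tensor_mul,
    realSign_add, mul_smul]
  congr 1
  ext x y
  simp only [tensor, tensorMatrix, Matrix.of_apply, Matrix.smul_apply, smul_eq_mul]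
  rw [← Finset.mul_prod_erase _ _ (Finset.mem_univ i),
    ← Finset.mul_prod_erase (a := i) Finset.univ _ (Finset.mem_univ i), ← mul_assoc]
  congr 1
  · simpa using h (x i) (y i)
  · refine Finset.prod_congr rfl fun j hj => ?_
    have hj : j ≠ i := Finset.ne_of_mem_erase hj
    simp [hj]

/-- With `a` and `b` the `x` bits of `p` on `i` and `j`, expand the exponent `(yᵢ + a) * (yⱼ + b)`
of the diagonal sign: the cross terms are the new letters `Z`, and `a * b` is the change of sign. -/
theorem controlledZ_mul_op {n : ℕ} (i j : Fin n) (hij : i ≠ j) (p : PauliWord n) :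
    controlledZ i j * p.op = PauliWord.op ⟨p.s + (p.v i).1 * (p.v j).1,
      Function.update (Function.update p.v i (p.v i + (0, (p.v j).1))) j
        (p.v j + (0, (p.v i).1))⟩ * controlledZ i j := by
  have hd : ∀ x : Fin n → Fin 2, (if x i = 1 ∧ x j = 1 then (-1 : ℝ) else 1) =
      realSign (x i * x j) := by
    have h : ∀ s : Fin 2, s = 0 ∨ s = 1 := by decide
    intro x
    rcases h (x i) with hi | hi <;> rcases h (x j) with hj | hj <;>
      simp [hi, hj, realSign]
  apply Subtype.ext
  ext x y
  simp only [Submonoid.coe_mul, controlledZ, Matrix.diagonal_mul, Matrix.mul_diagonal]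
  rw [PauliWord.op_apply, PauliWord.op_apply]
  set w : Fin n → Letter := Function.update (Function.update p.v i (p.v i + (0, (p.v j).1))) j
    (p.v j + (0, (p.v i).1)) with hw
  have hwi : w i = p.v i + (0, (p.v j).1) := by simp [hw, hij]
  have hwj : w j = p.v j + (0, (p.v i).1) := by simp [hw]
  have hwk : ∀ k, k ≠ i → k ≠ j → w k = p.v k := fun k h1 h2 => by simp [hw, h1, h2]
  have hw1 : ∀ k, (w k).1 = (p.v k).1 := by
    intro k
    by_cases h1 : k = i
    · subst h1; simp [hwi]
    by_cases h2 : k = j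
    · subst h2; simp [hwj]
    rw [hwk k h1 h2]
  have hsum : ∑ k, (w k).2 * y k =
      ∑ k, (p.v k).2 * y k + (p.v j).1 * y i + (p.v i).1 * y j := by
    have : ∀ k, (w k).2 * y k = (p.v k).2 * y k + (if k = i then (p.v j).1 * y i else 0) +
        if k = j then (p.v i).1 * y j else 0 := by
      intro k
      by_cases h1 : k = i
      · subst h1; simp [hwi, hij, add_mul]
      by_cases h2 : k = j
      · subst h2; simp [hwj, h1, add_mul]
      simp [hwk k h1 h2, h1, h2]
    simp only [this, Finset.sum_add_distrib, Finset.sum_ite_eq', Finset.mem_univ, if_true]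
  simp only [hw1]
  rw [hd x, hd y]
  split_ifs with hx
  · rw [← realSign_add, ← realSign_add, hsum, hx]
    congr 1
    ring
  · simp

theorem Gate.op_mul_op {n : ℕ} (g : Gate n) (p : PauliWord n) :
    g.op * p.op = (g.act p).op * g.op := by
  cases g with
  | H i => exact onWire_mul_op i _ p _ _ fun x y => hadamard_mul_letter _ x y
  | Z i =>
    have := onWire_mul_op i pauliZ p (p.v i).1 (p.v i) fun x y => pauliZ_mul_letter _ x y
    rwa [Function.update_eq_self] at this
  | CZ i h => exact controlledZ_mul_op _ _ (by simp [Fin.ext_iff]) p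

/-- Conjugation by a circuit, on symbolic Pauli operators. -/
def Circuit.act {n : ℕ} : Circuit n → PauliWord n → PauliWord n
  | [], p => p
  | g :: w, p => Circuit.act w (g.act p)

theorem Circuit.act_cons {n : ℕ} (g : Gate n) (w : Circuit n) (p : PauliWord n) :
    Circuit.act (g :: w) p = Circuit.act w (g.act p) := rfl

theorem Circuit.act_append {n : ℕ} (w₁ w₂ : Circuit n) (p : PauliWord n) :
    Circuit.act (w₁ ++ w₂) p = Circuit.act w₂ (Circuit.act w₁ p) := by
  induction w₁ generalizing p with
  | nil => rfl
  | cons g w ih => exact ih _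

theorem Circuit.op_mul_op {n : ℕ} (w : Circuit n) (p : PauliWord n) :
    w.op * p.op = (w.act p).op * w.op := by
  induction w generalizing p with
  | nil => simp [Circuit.op, Circuit.act]
  | cons g w ih => rw [Circuit.op, mul_assoc, g.op_mul_op, ← mul_assoc, ih, mul_assoc]; rfl

theorem Circuit.op_act {n : ℕ} (w : Circuit n) (p : PauliWord n) :
    (w.act p).op = w.op * p.op * w.op⁻¹ := by
  rw [w.op_mul_op, mul_inv_cancel_right]

theorem Circuit.act_mul {n : ℕ} (w : Circuit n) (p q : PauliWord n) :
    w.act (p * q) = w.act p * w.act q := by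
  apply PauliWord.op_injective
  simp only [PauliWord.op_mul, Circuit.op_act]
  group

theorem Circuit.act_injective {n : ℕ} (w : Circuit n) : Function.Injective w.act := by
  intro p q h
  have h1 := congrArg PauliWord.op h
  rw [Circuit.op_act, Circuit.op_act] at h1
  exact PauliWord.op_injective (mul_left_cancel (mul_right_cancel h1))

theorem Circuit.act_one {n : ℕ} (w : Circuit n) : w.act 1 = 1 := by
  apply PauliWord.op_injective
  simp [Circuit.op_act, PauliWord.op_one]

theorem Circuit.act_mul_self {n : ℕ} (w : Circuit n) {p : PauliWord n} (hp : p * p = 1) :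
    w.act p * w.act p = 1 := by
  rw [← w.act_mul, hp, w.act_one]

/-! ### Circuits on two adjacent wires -/

/-- A sign and the letters on two adjacent wires. -/
abbrev LocalState : Type := Fin 2 × Letter × Letter

/-- The gates on two adjacent wires: `H` on the top wire, `H` on the bottom wire, and `CZ`. -/
inductive LocalGate : Type
  | top
  | bot
  | both

/-- The gate on the wires `i` and `i + 1` of `n`. -/
def LocalGate.gate {n : ℕ} (i : ℕ) (h : i + 1 < n) : LocalGate → Gate n
  | .top => .H ⟨i, by omega⟩
  | .bot => .H ⟨i + 1, h⟩
  | .both => .CZ i h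

/-- Conjugation by a gate, on symbolic Pauli operators on two wires. -/
def LocalGate.act : LocalGate → LocalState → LocalState
  | .top, (s, a, b) => (s + a.1 * a.2, a.swap, b)
  | .bot, (s, a, b) => (s + b.1 * b.2, a, b.swap)
  | .both, (s, a, b) => (s + a.1 * b.1, a + (0, b.1), b + (0, a.1))

/-- Conjugation by a word, on symbolic Pauli operators on two wires. -/
def localAct : List LocalGate → LocalState → LocalState
  | [], x => x
  | g :: w, x => localAct w (g.act x)

namespace PauliWord

variable {n : ℕ}

/-- The restriction to the wires `i` and `i + 1`. -/
def look (p : PauliWord n) (i : ℕ) (h : i + 1 < n) : LocalState :=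
  (p.s, p.v ⟨i, by omega⟩, p.v ⟨i + 1, h⟩)

/-- Replace the sign and the letters on the wires `i` and `i + 1`. -/
def place (p : PauliWord n) (i : ℕ) (h : i + 1 < n) (x : LocalState) : PauliWord n :=
  ⟨x.1, Function.update (Function.update p.v ⟨i, by omega⟩ x.2.1) ⟨i + 1, h⟩ x.2.2⟩

theorem place_s (p : PauliWord n) (i : ℕ) (h : i + 1 < n) (x : LocalState) :
    (p.place i h x).s = x.1 := rfl

theorem place_v_top (p : PauliWord n) (i : ℕ) (h : i + 1 < n) (x : LocalState) (h' : i < n) :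
    (p.place i h x).v ⟨i, h'⟩ = x.2.1 := by
  simp [place]

theorem place_v_bot (p : PauliWord n) (i : ℕ) (h : i + 1 < n) (x : LocalState) (h' : i + 1 < n) :
    (p.place i h x).v ⟨i + 1, h'⟩ = x.2.2 := by
  simp [place]

theorem place_v_of_ne (p : PauliWord n) (i : ℕ) (h : i + 1 < n) (x : LocalState) (j : Fin n)
    (h₁ : j.val ≠ i) (h₂ : j.val ≠ i + 1) : (p.place i h x).v j = p.v j := by
  simp [place, Fin.ext_iff, h₁, h₂]

theorem place_look (p : PauliWord n) (i : ℕ) (h : i + 1 < n) : p.place i h (p.look i h) = p := by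
  simp [place, look]

theorem look_place (p : PauliWord n) (i : ℕ) (h : i + 1 < n) (x : LocalState) :
    (p.place i h x).look i h = x := by
  simp only [look, place_s, place_v_top, place_v_bot]

theorem place_place (p : PauliWord n) (i : ℕ) (h : i + 1 < n) (x y : LocalState) :
    (p.place i h x).place i h y = p.place i h y := by
  refine PauliWord.ext rfl (funext fun j => ?_)
  by_cases h₁ : j.val = i
  · obtain ⟨j, hj⟩ := j
    obtain rfl : j = i := h₁
    rw [place_v_top, place_v_top]
  by_cases h₂ : j.val = i + 1
  · obtain ⟨j, hj⟩ := j
    obtain rfl : j = i + 1 := h₂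
    rw [place_v_bot, place_v_bot]
  simp only [place_v_of_ne _ _ _ _ j h₁ h₂]

end PauliWord

theorem LocalGate.gate_act {n : ℕ} (i : ℕ) (h : i + 1 < n) (g : LocalGate) (p : PauliWord n) :
    (g.gate i h).act p = p.place i h (g.act (p.look i h)) := by
  cases g with
  | top =>
    refine PauliWord.ext rfl (funext fun j => ?_)
    simp only [LocalGate.gate, Gate.act, PauliWord.place, LocalGate.act, PauliWord.look,
      Function.update_apply, Fin.ext_iff]
    split_ifs with h₁ h₂ h₂
    · omega
    · rfl
    · rw [← show j = ⟨i + 1, h⟩ from Fin.ext h₂]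
    · rfl
  | bot =>
    simp [LocalGate.gate, Gate.act, PauliWord.place, LocalGate.act, PauliWord.look]
  | both =>
    simp [LocalGate.gate, Gate.act, PauliWord.place, LocalGate.act, PauliWord.look]

/-- Reduces a word on two adjacent wires of any circuit to a function on finitely many states, so
that `decide` can treat the derived generators. -/
theorem act_map_gate {n : ℕ} (i : ℕ) (h : i + 1 < n) (w : List LocalGate) (p : PauliWord n) :
    Circuit.act (w.map (LocalGate.gate i h)) p = p.place i h (localAct w (p.look i h)) := by
  induction w generalizing p with
  | nil => exact (p.place_look i h).symm
  | cons g w ih =>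
    rw [List.map_cons, Circuit.act_cons, ih, LocalGate.gate_act, PauliWord.place_place,
      PauliWord.look_place]
    rfl

/-! ### The derived generators -/

/-- The word of a `B` gate. -/
def GateB.word {t u : WireType} : GateB t u → List LocalGate
  | .B1 | .B5 => [.bot, .both, .bot, .top, .both, .bot, .top, .both]
  | .B2 | .B6 => [.both, .bot, .top, .both]
  | .B3 | .B7 => [.top, .both, .bot, .top, .both]
  | .B4 | .B8 => [.bot, .both, .bot, .both, .bot, .top, .both]

theorem GateB.circuit_act {n : ℕ} {t u : WireType} (i : ℕ) (h : i + 1 < n) (b : GateB t u)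
    (p : PauliWord n) :
    (b.circuit i h).act p = p.place i h (localAct b.word (p.look i h)) := by
  rw [← act_map_gate]
  cases b <;> rfl

/-- The word of a `D` gate. -/
def GateD.word : GateD → List LocalGate
  | .D1 => [.both, .bot, .top, .both, .bot, .top, .both, .bot]
  | .D2 => [.top, .both, .bot, .top, .both, .bot]
  | .D3 => [.bot, .top, .both, .bot, .top, .both, .bot]
  | .D4 => [.top, .both, .bot, .top, .both, .bot, .both]

theorem GateD.circuit_act {n : ℕ} (i : ℕ) (h : i + 1 < n) (d : GateD) (p : PauliWord n) :
    (d.circuit i h).act p = p.place i h (localAct d.word (p.look i h)) := by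
  rw [← act_map_gate]
  cases d <;> rfl

/-- The letter on a wire of the given type: `Z` on a single wire, `XZ` on a double wire. -/
def WireType.letter : WireType → Letter
  | single => (0, 1)
  | double => (1, 1)

/-- The letter on the input wire of an `A` gate. -/
def GateA.source {t : WireType} : GateA t → Letter
  | .A1 => (0, 1)
  | .A2 => (1, 0)
  | .A3 => (1, 1)

/-- The letter on the upper input wire of a `B` gate. -/
def GateB.source {t u : WireType} : GateB t u → Letter
  | .B1 | .B5 => (0, 0)
  | .B2 | .B6 => (1, 0)
  | .B3 | .B7 => (0, 1)
  | .B4 | .B8 => (1, 1)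

/-- The letter on the lower input wire of a `D` gate. -/
def GateD.source : GateD → Letter
  | .D1 => (0, 0)
  | .D2 => (1, 0)
  | .D3 => (0, 1)
  | .D4 => (1, 1)

theorem GateA.source_ne_zero {t : WireType} (a : GateA t) : a.source ≠ 0 := by
  cases a <;> decide

theorem GateA.exists_source_eq {x : Letter} (hx : x ≠ 0) : ∃ t, ∃ a : GateA t, a.source = x := by
  have h : ∀ x : Letter, x ≠ 0 → x = (0, 1) ∨ x = (1, 0) ∨ x = (1, 1) := by decide
  rcases h x hx with rfl | rfl | rfl
  exacts [⟨_, .A1, rfl⟩, ⟨_, .A2, rfl⟩, ⟨_, .A3, rfl⟩]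

theorem GateA.eq_of_source_eq {t t' : WireType} {a : GateA t} {a' : GateA t'}
    (h : a.source = a'.source) : t = t' ∧ a ≍ a' := by
  cases a <;> cases a' <;> first | exact ⟨rfl, HEq.rfl⟩ | exact absurd h (by decide)

theorem GateB.exists_source_eq (t : WireType) (x : Letter) :
    ∃ u, ∃ b : GateB t u, b.source = x := by
  have h : ∀ x : Letter, x = (0, 0) ∨ x = (1, 0) ∨ x = (0, 1) ∨ x = (1, 1) := by decide
  cases t <;> rcases h x with rfl | rfl | rfl | rfl
  exacts [⟨_, .B1, rfl⟩, ⟨_, .B2, rfl⟩, ⟨_, .B3, rfl⟩, ⟨_, .B4, rfl⟩,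
    ⟨_, .B5, rfl⟩, ⟨_, .B6, rfl⟩, ⟨_, .B7, rfl⟩, ⟨_, .B8, rfl⟩]

/-- Gates such as `B1` and `B5` share circuit and source, and only the common input type separates
them; the output type is then forced. -/
theorem GateB.eq_of_source_eq {t u u' : WireType} {b : GateB t u} {b' : GateB t u'}
    (h : b.source = b'.source) : u = u' ∧ b ≍ b' := by
  cases b <;> cases b' <;> first | exact ⟨rfl, HEq.rfl⟩ | exact absurd h (by decide)

theorem GateD.exists_source_eq (x : Letter) : ∃ d : GateD, d.source = x := by
  have h : ∀ x : Letter, x = (0, 0) ∨ x = (1, 0) ∨ x = (0, 1) ∨ x = (1, 1) := by decide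
  rcases h x with rfl | rfl | rfl | rfl
  exacts [⟨.D1, rfl⟩, ⟨.D2, rfl⟩, ⟨.D3, rfl⟩, ⟨.D4, rfl⟩]

theorem GateD.source_injective : Function.Injective GateD.source := by
  intro d d' h
  cases d <;> cases d' <;> first | rfl | exact absurd h (by decide)

/-- The defining property of a `B` gate: it clears the lower wire and passes the typed letter upward
for one input pair of letters only. The equivalence yields both existence and uniqueness of ladders.
-/
theorem GateB.localAct_word {t u : WireType} (b : GateB t u) (x : LocalState) :
    (localAct b.word x).2.1 = u.letter ∧ (localAct b.word x).2.2 = 0 ↔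
      x.2.1 = b.source ∧ x.2.2 = t.letter := by
  revert x
  cases b <;> decide

/-- A `D` gate moves `Z` from top to bottom, so anticommuting with `Z` is passed down as well. A `Z`
factor on the upper input just moves down, so only the lower letter decides whether the upper wire
is cleared. -/
theorem GateD.localAct_word (d : GateD) (x : LocalState) (hx : x.2.1.1 = 1) :
    ((localAct d.word x).2.1 = 0 ↔ x.2.2 = d.source) ∧
      ((localAct d.word x).2.1 = 0 → (localAct d.word x).2.2.1 = 1) := by
  revert x
  cases d <;> decide

theorem GateD.localAct_word_Z (d : GateD) :
    localAct d.word (0, (0, 1), 0) = (0, 0, (0, 1)) := by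
  cases d <;> decide

/-! ### Z-circuits -/

/-- The bottommost nontrivial letter is on wire `k`, and it is the one of type `t`. -/
def EndsAt {n : ℕ} (k : ℕ) (h : k < n) (t : WireType) (p : PauliWord n) : Prop :=
  p.v ⟨k, h⟩ = t.letter ∧ ∀ j : Fin n, k < j.val → p.v j = 0

theorem GateB.endsAt_act_iff {n : ℕ} {t u : WireType} (b : GateB t u) (k : ℕ) (h : k + 1 < n)
    (p : PauliWord n) :
    EndsAt k (by omega) u ((b.circuit k h).act p) ↔
      p.v ⟨k, by omega⟩ = b.source ∧ EndsAt (k + 1) h t p := by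
  have key := b.localAct_word (p.look k h)
  rw [GateB.circuit_act, EndsAt, EndsAt, PauliWord.place_v_top]
  constructor
  · rintro ⟨h₁, h₂⟩
    obtain ⟨h₃, h₄⟩ := key.1 ⟨h₁, by
      rw [← h₂ ⟨k + 1, h⟩ (Nat.lt_succ_self k), PauliWord.place_v_bot]⟩
    refine ⟨h₃, h₄, fun j hj => ?_⟩
    rw [← h₂ j (by omega), PauliWord.place_v_of_ne _ _ _ _ _ (by omega) (by omega)]
  · rintro ⟨h₁, h₂, h₃⟩
    obtain ⟨h₄, h₅⟩ := key.2 ⟨h₁, h₂⟩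
    refine ⟨h₄, fun j hj => ?_⟩
    by_cases hj' : j.val = k + 1
    · obtain rfl : j = ⟨k + 1, h⟩ := Fin.ext hj'
      rw [PauliWord.place_v_bot]
      exact h₅
    · rw [PauliWord.place_v_of_ne _ _ _ _ _ (by omega) hj']
      exact h₃ j (by omega)

theorem BLadder.cons_act {n k : ℕ} {t u : WireType} (b : GateB t u) (l : BLadder k u)
    (h : k + 1 < n) (p : PauliWord n) :
    Circuit.act ((BLadder.cons b l).circuit n h) p =
      Circuit.act (l.circuit n (by omega)) (Circuit.act (b.circuit k h) p) := by
  rw [BLadder.circuit, Circuit.act_append]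

/-- Reads the ladder backwards: a correct final result forces the letter at its start and triviality
below, whichever gates were used. -/
theorem BLadder.endsAt_of_act {n k : ℕ} {t : WireType} (l : BLadder k t) (h : k < n)
    (p : PauliWord n) (hl : EndsAt 0 (by omega) single ((l.circuit n h).act p)) :
    EndsAt k h t p := by
  induction l generalizing p with
  | nil => exact hl
  | cons b l ih =>
    rw [BLadder.cons_act] at hl
    exact ((b.endsAt_act_iff _ h p).1 (ih _ _ hl)).2

theorem BLadder.eq_of_endsAt {n k : ℕ} {t : WireType} (l l' : BLadder k t) (h : k < n)
    (p : PauliWord n) (hl : EndsAt 0 (by omega) single ((l.circuit n h).act p))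
    (hl' : EndsAt 0 (by omega) single ((l'.circuit n h).act p)) : l = l' := by
  induction l generalizing p with
  | nil => cases l'; rfl
  | cons b l ih =>
    cases l' with
    | cons b' l' =>
      rw [BLadder.cons_act] at hl hl'
      have hb := ((b.endsAt_act_iff _ h p).1 (l.endsAt_of_act _ _ hl)).1
      have hb' := ((b'.endsAt_act_iff _ h p).1 (l'.endsAt_of_act _ _ hl')).1
      obtain ⟨rfl, hbb⟩ := GateB.eq_of_source_eq (hb.symm.trans hb')
      obtain rfl := eq_of_heq hbb
      rw [ih l' _ _ hl hl']

/-- Since `XZ` squares to `-1` and the other letters to `1`, the number of letters `XZ` must be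
even. -/
theorem PauliWord.sum_eq_zero {n : ℕ} {p : PauliWord n} (hp : p * p = 1) :
    ∑ i, (p.v i).2 * (p.v i).1 = 0 := by
  have := congrArg PauliWord.s hp
  rwa [PauliWord.mul_s, fin_two_add_self, zero_add] at this

theorem BLadder.exists_endsAt {n k : ℕ} {t : WireType} (h : k < n) (p : PauliWord n)
    (hp : EndsAt k h t p) (hsq : p * p = 1) :
    ∃ l : BLadder k t, EndsAt 0 (by omega) single ((l.circuit n h).act p) := by
  induction k generalizing t p with
  | zero =>
    cases t with
    | single => exact ⟨.nil, hp⟩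
    | double =>
      -- A double type on the top wire would leave a single letter `XZ`, an odd number.
      have h₁ := PauliWord.sum_eq_zero hsq
      rw [Finset.sum_eq_single ⟨0, h⟩, hp.1] at h₁
      · exact absurd h₁ (by decide)
      · intro j _ hj
        rw [hp.2 j (by
          rw [Ne, Fin.ext_iff] at hj
          exact Nat.pos_of_ne_zero hj)]
        rfl
      · simp
  | succ k ih =>
    obtain ⟨u, b, hb⟩ := GateB.exists_source_eq t (p.v ⟨k, by omega⟩)
    obtain ⟨l, hl⟩ := ih (by omega) _ ((b.endsAt_act_iff k h p).2 ⟨hb.symm, hp⟩)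
      (Circuit.act_mul_self _ hsq)
    exact ⟨.cons b l, by rwa [BLadder.cons_act]⟩

/-- The Pauli operator `X` on wire `i`. -/
def wordX {n : ℕ} (i : Fin n) : PauliWord n := ⟨0, Pi.single i (1, 0)⟩

/-- The Pauli operator `Z` on wire `i`. -/
def wordZ {n : ℕ} (i : Fin n) : PauliWord n := ⟨0, Pi.single i (0, 1)⟩

theorem endsAt_zero_iff {n : ℕ} (p : PauliWord (n + 1)) :
    EndsAt 0 (by omega) single p ↔ p.v = (Pi.single 0 (0, 1) : Fin (n + 1) → Letter) := by
  constructor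
  · rintro ⟨h₁, h₂⟩
    funext j
    by_cases hj : j = 0
    · subst hj
      rw [Pi.single_eq_same]
      exact h₁
    · rw [Pi.single_eq_of_ne hj]
      exact h₂ j (Nat.pos_of_ne_zero fun h => hj (Fin.ext h))
  · intro h
    refine ⟨by rw [h]; exact Pi.single_eq_same _ _, fun j hj => ?_⟩
    rw [h, Pi.single_eq_of_ne]
    rintro rfl
    exact absurd hj (by simp)

/-- The sign removed by a `C` gate. -/
def GateC.sign : GateC → Fin 2
  | .C1 => 0
  | .C2 => 1

theorem GateC.act_eq_iff {n : ℕ} (c : GateC) (p : PauliWord (n + 1)) :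
    (c.circuit 0).act p = wordZ 0 ↔ EndsAt 0 (by omega) single p ∧ p.s = c.sign := by
  rw [endsAt_zero_iff]
  have hc : (c.circuit 0).act p = ⟨p.s + c.sign * (p.v 0).2, p.v⟩ := by
    cases c with
    | C1 => simp [GateC.circuit, Circuit.act, GateC.sign]
    | C2 =>
      -- The signs `x * z` of the two `H` gates cancel, leaving that of `X` past `Z ^ z`.
      have : ∀ s x z : Fin 2, s + x * z + z + z * x = s + 1 * z := by decide
      simp [GateC.circuit, Circuit.act, GateC.sign, Gate.act, this]
  rw [hc, wordZ, PauliWord.ext_iff, and_comm]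
  refine and_congr_right fun hv => ?_
  have : ∀ s c : Fin 2, s + c * 1 = 0 ↔ s = c := by decide
  dsimp only at hv ⊢
  rw [hv, Pi.single_eq_same]
  exact this _ _

theorem GateA.endsAt_act_iff {n : ℕ} {t : WireType} (a : GateA t) (i : Fin n) (p : PauliWord n) :
    EndsAt i.val i.isLt t ((a.circuit i).act p) ↔
      p.v i = a.source ∧ ∀ j : Fin n, i.val < j.val → p.v j = 0 := by
  cases a with
  | A1 => rfl
  | A3 => rfl
  | A2 =>
    have h : ∀ x : Letter, x.swap = (0, 1) ↔ x = (1, 0) := by decide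
    simp only [GateA.circuit, Circuit.act, Gate.act, EndsAt, WireType.letter, GateA.source,
      Function.update_self, h]
    refine and_congr_right fun _ => forall_congr' fun j => imp_congr_right fun hj => ?_
    rw [Function.update_of_ne]
    rintro rfl
    exact lt_irrefl _ hj

theorem ZCircuit.act_eq_iff {n : ℕ} (L : ZCircuit n) (p : PauliWord (n + 1)) :
    L.circuit.act p = wordZ 0 ↔
      EndsAt 0 (by omega) single
        (Circuit.act (L.ladder.circuit (n + 1) L.m.isLt) (Circuit.act (L.a.circuit L.m) p)) ∧
      (Circuit.act (L.ladder.circuit (n + 1) L.m.isLt) (Circuit.act (L.a.circuit L.m) p)).s =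
        L.c.sign := by
  rw [ZCircuit.circuit, Circuit.act_append, Circuit.act_append, GateC.act_eq_iff]

/-- Every Pauli operator other than `±1` that squares to `1` is turned into `Z` on the top wire by
exactly one `Z`-circuit. -/
theorem existsUnique_zCircuit {n : ℕ} (p : PauliWord (n + 1)) (hv : p.v ≠ 0) (hsq : p * p = 1) :
    ∃! L : ZCircuit n, L.circuit.act p = wordZ 0 := by
  apply existsUnique_of_exists_of_unique
  · obtain ⟨i, hi⟩ := Function.ne_iff.1 hv
    obtain ⟨m, hm, hmax⟩ := Finset.exists_max_image (Finset.univ.filter fun j => p.v j ≠ 0) id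
      ⟨i, by simpa using hi⟩
    have hm : p.v m ≠ 0 := by simpa using hm
    have hmax : ∀ j : Fin (n + 1), m.val < j.val → p.v j = 0 := by
      intro j hj
      by_contra h
      exact absurd (hmax j (by simpa using h)) (not_le.2 hj)
    obtain ⟨t, a, ha⟩ := GateA.exists_source_eq hm
    obtain ⟨l, hl⟩ := BLadder.exists_endsAt m.isLt _ ((a.endsAt_act_iff m p).2 ⟨ha.symm, hmax⟩)
      (Circuit.act_mul_self _ hsq)
    have hc : ∀ s, ∃ c : GateC, s = c.sign := by
      have : ∀ s : Fin 2, s = 0 ∨ s = 1 := by decide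
      intro s
      rcases this s with rfl | rfl
      exacts [⟨.C1, rfl⟩, ⟨.C2, rfl⟩]
    obtain ⟨c, hc⟩ := hc (Circuit.act (l.circuit (n + 1) m.isLt) (Circuit.act (a.circuit m) p)).s
    exact ⟨⟨m, t, a, l, c⟩, (ZCircuit.act_eq_iff _ p).2 ⟨hl, hc⟩⟩
  · rintro ⟨m, t, a, l, c⟩ ⟨m', t', a', l', c'⟩ h h'
    rw [ZCircuit.act_eq_iff] at h h'
    dsimp only at h h'
    obtain ⟨h, hc⟩ := h
    obtain ⟨h', hc'⟩ := h'
    obtain ⟨ha, hm⟩ := (a.endsAt_act_iff m p).1 (l.endsAt_of_act _ _ h)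
    obtain ⟨ha', hm'⟩ := (a'.endsAt_act_iff m' p).1 (l'.endsAt_of_act _ _ h')
    -- Both wires carry the bottommost nontrivial letter of `p`.
    obtain rfl : m = m' := by
      rcases lt_trichotomy m m' with hlt | heq | hlt
      · exact absurd (ha'.symm.trans (hm m' hlt)) a'.source_ne_zero
      · exact heq
      · exact absurd (ha.symm.trans (hm' m hlt)) a.source_ne_zero
    obtain ⟨rfl, haa⟩ := GateA.eq_of_source_eq (ha.symm.trans ha')
    obtain rfl := eq_of_heq haa
    obtain rfl := BLadder.eq_of_endsAt l l' _ _ h h'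
    have hcc := hc.symm.trans hc'
    have : c = c' := by cases c <;> cases c' <;> first | rfl | exact absurd hcc (by decide)
    rw [this]

/-! ### X-circuits -/

/-- The first `k` of a family of `D` gates. -/
def ladderD {n : ℕ} (d : Fin n → GateD) (k : ℕ) (hk : k ≤ n) : Circuit (n + 1) :=
  (List.finRange k).flatMap fun i => (d (i.castLE hk)).circuit i.val (by omega)

theorem ladderD_succ_act {n : ℕ} (d : Fin n → GateD) (k : ℕ) (hk : k + 1 ≤ n)
    (p : PauliWord (n + 1)) :
    (ladderD d (k + 1) hk).act p =
      ((d ⟨k, hk⟩).circuit k (by omega)).act ((ladderD d k (by omega)).act p) := by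
  rw [ladderD, List.finRange_succ_last, List.flatMap_append, List.flatMap_map, Circuit.act_append]
  simp only [List.flatMap_cons, List.flatMap_nil, List.append_nil]
  rfl

/-- Holds for every choice of `D` gates, so the `D` gates are free to be chosen for the second Pauli
operator. -/
theorem ladderD_act_wordZ {n : ℕ} (d : Fin n → GateD) (k : ℕ) (hk : k ≤ n) :
    (ladderD d k hk).act (wordZ 0) = wordZ ⟨k, by omega⟩ := by
  induction k with
  | zero => rfl
  | succ k ih =>
    rw [ladderD_succ_act, ih, GateD.circuit_act]
    have : (wordZ ⟨k, by omega⟩ : PauliWord (n + 1)).look k (by omega) = (0, (0, 1), 0) := by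
      simp [wordZ, PauliWord.look]
    rw [this, GateD.localAct_word_Z]
    refine PauliWord.ext rfl (funext fun j => ?_)
    simp only [PauliWord.place, wordZ, Pi.single_apply, Function.update_apply, Fin.ext_iff]
    split_ifs <;> rfl

theorem ladderD_act_v_of_lt {n : ℕ} (d : Fin n → GateD) (k : ℕ) (hk : k ≤ n)
    (p : PauliWord (n + 1)) (j : Fin (n + 1)) (hj : k < j.val) :
    ((ladderD d k hk).act p).v j = p.v j := by
  induction k with
  | zero => rfl
  | succ k ih =>
    rw [ladderD_succ_act, GateD.circuit_act,
      PauliWord.place_v_of_ne _ _ _ _ _ (by omega) (by omega), ih (by omega) (by omega)]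

/-- The two claims need each other: the `x` bit on wire `k` is what lets the next `D` gate be read
off, and it survives once all wires above are cleared. The letter on wire `k + 1` is still the
original one. -/
theorem ladderD_act_iff {n : ℕ} (d : Fin n → GateD) (k : ℕ) (hk : k ≤ n)
    (p : PauliWord (n + 1)) (hp : (p.v 0).1 = 1) :
    ((∀ j : Fin (n + 1), j.val < k → ((ladderD d k hk).act p).v j = 0) ↔
      ∀ i : Fin n, i.val < k → p.v i.succ = (d i).source) ∧
    ((∀ j : Fin (n + 1), j.val < k → ((ladderD d k hk).act p).v j = 0) →
      (((ladderD d k hk).act p).v ⟨k, by omega⟩).1 = 1) := by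
  induction k with
  | zero => exact ⟨by simp, fun _ => hp⟩
  | succ k ih =>
    obtain ⟨ih₁, ih₂⟩ := ih (by omega)
    have hbot : ((ladderD d k (by omega)).act p).v ⟨k + 1, by omega⟩ =
        p.v (Fin.succ ⟨k, hk⟩) :=
      ladderD_act_v_of_lt d k (by omega) p _ (Nat.lt_succ_self k)
    have hkn : k < n + 1 := by omega
    rw [ladderD_succ_act, GateD.circuit_act]
    set q := (ladderD d k (by omega)).act p with hq
    have hsplit : (∀ j : Fin (n + 1), j.val < k + 1 →
        (q.place k (by omega) (localAct (d ⟨k, hk⟩).word (q.look k (by omega)))).v j = 0) ↔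
        (∀ j : Fin (n + 1), j.val < k → q.v j = 0) ∧
          (localAct (d ⟨k, hk⟩).word (q.look k (by omega))).2.1 = 0 := by
      constructor
      · intro h
        refine ⟨fun j hj => ?_, ?_⟩
        · rw [← h j (by omega), PauliWord.place_v_of_ne _ _ _ _ _ (by omega) (by omega)]
        · rw [← h ⟨k, by omega⟩ (Nat.lt_succ_self k), PauliWord.place_v_top]
      · rintro ⟨h₁, h₂⟩ j hj
        by_cases hjk : j.val = k
        · obtain rfl : j = ⟨k, hkn⟩ := Fin.ext hjk
          rw [PauliWord.place_v_top, h₂]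
        · rw [PauliWord.place_v_of_ne _ _ _ _ _ hjk (by omega), h₁ j (by omega)]
    rw [hsplit, PauliWord.place_v_bot]
    constructor
    · constructor
      · rintro ⟨h₁, h₂⟩ i hi
        by_cases hik : i.val = k
        · obtain rfl : i = ⟨k, hk⟩ := Fin.ext hik
          rw [← hbot]
          exact ((d ⟨k, hk⟩).localAct_word (q.look k (by omega)) (ih₂ h₁)).1.1 h₂
        · exact ih₁.1 h₁ i (by omega)
      · intro h
        have h₁ := ih₁.2 fun i hi => h i (by omega)
        refine ⟨h₁, ((d ⟨k, hk⟩).localAct_word (q.look k (by omega)) (ih₂ h₁)).1.2 ?_⟩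
        exact hbot.trans (h ⟨k, hk⟩ (Nat.lt_succ_self k))
    · rintro ⟨h₁, h₂⟩
      exact ((d ⟨k, hk⟩).localAct_word (q.look k (by omega)) (ih₂ h₁)).2 h₂

theorem XCircuit.circuit_act {n : ℕ} (M : XCircuit n) (p : PauliWord (n + 1)) :
    M.circuit.act p =
      (M.e.circuit (Fin.last n)).act ((ladderD M.d n le_rfl).act p) := by
  rw [XCircuit.circuit, Circuit.act_append]
  rfl

/-- The sign removed by an `E` gate. -/
def GateE.sign : GateE → Fin 2
  | .E1 => 0
  | .E2 => 1

theorem GateE.circuit_act {n : ℕ} (e : GateE) (i : Fin n) (p : PauliWord n) :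
    (e.circuit i).act p = ⟨p.s + e.sign * (p.v i).1, p.v⟩ := by
  cases e <;> simp [GateE.circuit, Circuit.act, GateE.sign, Gate.act]

theorem XCircuit.act_wordZ {n : ℕ} (M : XCircuit n) :
    M.circuit.act (wordZ 0) = wordZ (Fin.last n) := by
  rw [XCircuit.circuit_act, ladderD_act_wordZ, GateE.circuit_act]
  refine PauliWord.ext ?_ rfl
  change (0 : Fin 2) + M.e.sign * ((Pi.single (Fin.last n) (0, 1) : Fin (n + 1) → Letter)
    (Fin.last n)).1 = 0
  simp

theorem XCircuit.act_eq_iff {n : ℕ} (M : XCircuit n) (p : PauliWord (n + 1))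
    (hp : (p.v 0).1 = 1) (hsq : p * p = 1) :
    M.circuit.act p = wordX (Fin.last n) ↔
      (∀ i, p.v i.succ = (M.d i).source) ∧ ((ladderD M.d n le_rfl).act p).s = M.e.sign := by
  obtain ⟨key₁, key₂⟩ := ladderD_act_iff M.d n le_rfl p hp
  have key₁ : _ ↔ ∀ i, p.v i.succ = (M.d i).source := key₁.trans
    ⟨fun h i => h i i.isLt, fun h i _ => h i⟩
  rw [XCircuit.circuit_act, GateE.circuit_act, ← key₁]
  have hsq' := PauliWord.sum_eq_zero (Circuit.act_mul_self (ladderD M.d n le_rfl) hsq)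
  set q := (ladderD M.d n le_rfl).act p with hq
  have hv : q.v = Pi.single (Fin.last n) (1, 0) ↔ ∀ j : Fin (n + 1), j.val < n → q.v j = 0 := by
    constructor
    · intro h j hj
      rw [h, Pi.single_eq_of_ne]
      rintro rfl
      exact lt_irrefl _ hj
    · intro h
      have h0 : ∀ j, j ≠ Fin.last n → q.v j = 0 := fun j hj =>
        h j (Fin.val_lt_last hj)
      -- Squaring to `1` excludes `XZ` as the only remaining letter, so it is `X`.
      rw [Finset.sum_eq_single (Fin.last n) (fun j _ hj => by rw [h0 j hj]; rfl) (by simp)] at hsq'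
      have h1 : (q.v (Fin.last n)).1 = 1 := key₂ h
      rw [h1, mul_one] at hsq'
      funext j
      by_cases hj : j = Fin.last n
      · subst hj
        rw [Pi.single_eq_same]
        exact Prod.ext h1 hsq'
      · rw [Pi.single_eq_of_ne hj, h0 j hj]
  rw [← hv, wordX, PauliWord.ext_iff, and_comm]
  refine and_congr_right fun h => ?_
  have : ∀ s c : Fin 2, s + c * 1 = 0 ↔ s = c := by decide
  dsimp only at h ⊢
  rw [h, Pi.single_eq_same]
  exact this _ _

/-- Every Pauli operator that squares to `1` and anticommutes with `Z` on the top wire is turned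
into `X` on the bottom wire by exactly one `X`-circuit. -/
theorem existsUnique_xCircuit {n : ℕ} (p : PauliWord (n + 1)) (hp : (p.v 0).1 = 1)
    (hsq : p * p = 1) : ∃! M : XCircuit n, M.circuit.act p = wordX (Fin.last n) := by
  have he : ∀ s, ∃ e : GateE, s = e.sign := by
    have : ∀ s : Fin 2, s = 0 ∨ s = 1 := by decide
    intro s
    rcases this s with rfl | rfl
    exacts [⟨.E1, rfl⟩, ⟨.E2, rfl⟩]
  apply existsUnique_of_exists_of_unique
  · choose d hd using fun i : Fin n => GateD.exists_source_eq (p.v i.succ)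
    obtain ⟨e, he⟩ := he ((ladderD d n le_rfl).act p).s
    exact ⟨⟨d, e⟩, (XCircuit.act_eq_iff _ p hp hsq).2 ⟨fun i => (hd i).symm, he⟩⟩
  · rintro ⟨d, e⟩ ⟨d', e'⟩ h h'
    rw [XCircuit.act_eq_iff _ p hp hsq] at h h'
    obtain ⟨h, he⟩ := h
    obtain ⟨h', he'⟩ := h'
    obtain rfl : d = d' := funext fun i => GateD.source_injective ((h i).symm.trans (h' i))
    have hee : e.sign = e'.sign := he.symm.trans he'
    have : e = e' := by cases e <;> cases e' <;> first | rfl | exact absurd hee (by decide)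
    rw [this]

/-! ### Automorphisms of the symbolic Pauli group -/

instance (n : ℕ) : Finite (PauliWord n) :=
  Finite.of_injective (fun p : PauliWord n => (p.s, p.v)) fun _ _ h =>
    PauliWord.ext (congrArg Prod.fst h) (congrArg Prod.snd h)

/-- Conjugation by a circuit, as an automorphism. -/
def Circuit.actEquiv {n : ℕ} (w : Circuit n) : PauliWord n ≃* PauliWord n :=
  MulEquiv.ofBijective ({ toFun := w.act, map_mul' := w.act_mul } : PauliWord n →ₙ* PauliWord n)
    ⟨w.act_injective, Finite.surjective_of_injective w.act_injective⟩

theorem Circuit.actEquiv_apply {n : ℕ} (w : Circuit n) (p : PauliWord n) :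
    w.actEquiv p = w.act p := rfl

namespace PauliWord

variable {n : ℕ}

/-- The letters add commutatively, so only the signs matter: this is the vanishing of the symplectic
form. -/
theorem mul_eq_mul_iff (p q : PauliWord n) :
    p * q = q * p ↔ ∑ i, (p.v i).2 * (q.v i).1 = ∑ i, (q.v i).2 * (p.v i).1 := by
  rw [PauliWord.ext_iff, mul_s, mul_s, mul_v, mul_v, add_comm q.s, add_comm q.v]
  simp

theorem mul_wordZ_comm_iff (p : PauliWord n) (i : Fin n) :
    p * wordZ i = wordZ i * p ↔ (p.v i).1 = 0 := by
  rw [mul_eq_mul_iff, Finset.sum_eq_zero, Finset.sum_eq_single i]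
  · simp [wordZ, eq_comm]
  · intro j _ hj
    simp [wordZ, hj]
  · simp
  · intro j _
    by_cases hj : j = i
    · subst hj; simp [wordZ]
    · simp [wordZ, hj]

theorem mul_wordX_comm_iff (p : PauliWord n) (i : Fin n) :
    p * wordX i = wordX i * p ↔ (p.v i).2 = 0 := by
  rw [mul_eq_mul_iff, Finset.sum_eq_single i]
  · rw [Finset.sum_eq_zero]
    · simp [wordX]
    · intro j _
      by_cases hj : j = i
      · subst hj; simp [wordX]
      · simp [wordX, hj]
  · intro j _ hj
    simp [wordX, hj]
  · simp

theorem mul_self_eq_one_iff (p : PauliWord n) :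
    p * p = 1 ↔ ∑ i, (p.v i).2 * (p.v i).1 = 0 := by
  refine ⟨sum_eq_zero, fun h => PauliWord.ext ?_ ?_⟩
  · rw [mul_s, h, fin_two_add_self, zero_add, one_s]
  · funext i
    exact Prod.ext (fin_two_add_self _) (fin_two_add_self _)

theorem wordZ_mul_self (i : Fin n) : wordZ i * wordZ i = 1 := by
  rw [mul_self_eq_one_iff]
  refine Finset.sum_eq_zero fun j _ => ?_
  by_cases hj : j = i
  · subst hj; simp [wordZ]
  · simp [wordZ, hj]

theorem wordX_mul_self (i : Fin n) : wordX i * wordX i = 1 := by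
  rw [mul_self_eq_one_iff]
  refine Finset.sum_eq_zero fun j _ => ?_
  by_cases hj : j = i
  · subst hj; simp [wordX]
  · simp [wordX, hj]

theorem wordX_mul_wordZ_ne (i : Fin n) : wordX i * wordZ i ≠ wordZ i * wordX i := by
  rw [Ne, mul_wordZ_comm_iff]
  simp [wordX]

/-- The restriction to the first `n` wires. -/
def restrict (p : PauliWord (n + 1)) : PauliWord n := ⟨p.s, fun i => p.v i.castSucc⟩

/-- The extension by a trivial letter on the last wire. -/
def extend (p : PauliWord n) : PauliWord (n + 1) :=
  ⟨p.s, Fin.snoc (α := fun _ => Letter) p.v 0⟩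

theorem ext_restrict {p q : PauliWord (n + 1)} (h : p.restrict = q.restrict)
    (hl : p.v (Fin.last n) = q.v (Fin.last n)) : p = q := by
  refine PauliWord.ext (congrArg s h :) (funext fun i => ?_)
  induction i using Fin.lastCases with
  | last => exact hl
  | cast i => exact congrFun (congrArg v h) i

theorem restrict_extend (p : PauliWord n) : p.extend.restrict = p := by
  simp [restrict, extend]

theorem extend_v_last (p : PauliWord n) : p.extend.v (Fin.last n) = 0 := by
  simp [extend]

theorem extend_restrict {p : PauliWord (n + 1)} (h : p.v (Fin.last n) = 0) :
    p.restrict.extend = p :=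
  ext_restrict (restrict_extend _) (by rw [extend_v_last, h])

theorem extend_injective : Function.Injective (extend : PauliWord n → PauliWord (n + 1)) :=
  fun p q h => by rw [← restrict_extend p, h, restrict_extend]

/-- Unlike for `restrict`, the last wire contributes no sign here. -/
theorem extend_mul (p q : PauliWord n) : (p * q).extend = p.extend * q.extend := by
  refine ext_restrict (PauliWord.ext ?_ (funext fun i => ?_)) ?_
  · simp [restrict, extend, mul_s, Fin.sum_univ_castSucc]
  · simp [restrict, extend, mul_v]
  · simp [extend, mul_v]

theorem restrict_single_last (a : Letter) :
    restrict (⟨0, Pi.single (Fin.last n) a⟩ : PauliWord (n + 1)) = 1 := by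
  refine PauliWord.ext rfl (funext fun i => ?_)
  simp [restrict, one_v, Fin.castSucc_ne_last]

theorem eq_extend_restrict_mul (p : PauliWord (n + 1)) :
    p = p.restrict.extend * ⟨0, Pi.single (Fin.last n) (p.v (Fin.last n))⟩ := by
  refine ext_restrict (PauliWord.ext ?_ (funext fun i => ?_)) ?_
  · simp [restrict, extend, mul_s, Fin.sum_univ_castSucc, Fin.castSucc_ne_last]
  · simp [restrict, extend, mul_v, Fin.castSucc_ne_last]
  · simp [extend, mul_v]

theorem mk_single (i : Fin n) (a : Letter) : (⟨0, Pi.single i a⟩ : PauliWord n) =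
    (if a.1 = 0 then 1 else wordX i) * (if a.2 = 0 then 1 else wordZ i) := by
  have h : ∀ a : Letter, a = (0, 0) ∨ a = (1, 0) ∨ a = (0, 1) ∨ a = (1, 1) := by decide
  rcases h a with rfl | rfl | rfl | rfl
  · simp only [if_true, mul_one]
    exact PauliWord.ext rfl (Pi.single_zero i)
  · simp [wordX]
  · simp [wordZ]
  · simp only [one_ne_zero, if_false]
    refine PauliWord.ext ?_ ?_
    · rw [mul_s, Finset.sum_eq_zero]
      · rfl
      · intro j _
        by_cases hj : j = i
        · subst hj; simp [wordX]
        · simp [wordX, hj]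
    · rw [mul_v, wordX, wordZ, ← Pi.single_add]
      rfl

/-- Automorphisms are determined by their values on the first `n` wires and on `X` and `Z` on the
last wire. -/
theorem mulEquiv_ext {f g : PauliWord (n + 1) ≃* PauliWord (n + 1)}
    (h : ∀ p : PauliWord n, f p.extend = g p.extend)
    (hX : f (wordX (Fin.last n)) = g (wordX (Fin.last n)))
    (hZ : f (wordZ (Fin.last n)) = g (wordZ (Fin.last n))) : f = g := by
  ext1 p
  rw [eq_extend_restrict_mul p, mk_single, map_mul, map_mul, map_mul, map_mul, h]
  congr 2
  · split_ifs <;> simp [hX]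
  · split_ifs <;> simp [hZ]

/-- The image still commutes with `f X = X` and `f Z = Z` on the last wire, and only the trivial
letter commutes with both. -/
theorem v_last_eq_zero {f : PauliWord (n + 1) ≃* PauliWord (n + 1)}
    (hX : f (wordX (Fin.last n)) = wordX (Fin.last n))
    (hZ : f (wordZ (Fin.last n)) = wordZ (Fin.last n)) (p : PauliWord n) :
    (f p.extend).v (Fin.last n) = 0 := by
  apply Prod.ext
  · refine (mul_wordZ_comm_iff _ _).1 ?_
    rw [← hZ, ← map_mul, (mul_wordZ_comm_iff _ _).2 (by rw [extend_v_last]; rfl), map_mul]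
  · refine (mul_wordX_comm_iff _ _).1 ?_
    rw [← hX, ← map_mul, (mul_wordX_comm_iff _ _).2 (by rw [extend_v_last]; rfl), map_mul]

/-- An automorphism that fixes `X` and `Z` on the last wire restricts to the first `n` wires. -/
def restrictEquiv (f : PauliWord (n + 1) ≃* PauliWord (n + 1))
    (hX : f (wordX (Fin.last n)) = wordX (Fin.last n))
    (hZ : f (wordZ (Fin.last n)) = wordZ (Fin.last n)) : PauliWord n ≃* PauliWord n where
  toFun p := (f p.extend).restrict
  invFun p := (f.symm p.extend).restrict
  left_inv p := by
    dsimp only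
    rw [extend_restrict (v_last_eq_zero hX hZ p), f.symm_apply_apply, restrict_extend]
  right_inv p := by
    dsimp only
    rw [extend_restrict (v_last_eq_zero (f := f.symm) (by rw [f.symm_apply_eq, hX])
      (by rw [f.symm_apply_eq, hZ]) p), f.apply_symm_apply, restrict_extend]
  map_mul' p q := by
    apply extend_injective
    rw [extend_restrict (v_last_eq_zero hX hZ _), extend_mul, extend_mul, map_mul,
      extend_restrict (v_last_eq_zero hX hZ _), extend_restrict (v_last_eq_zero hX hZ _)]

theorem extend_restrictEquiv (f : PauliWord (n + 1) ≃* PauliWord (n + 1))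
    (hX : f (wordX (Fin.last n)) = wordX (Fin.last n))
    (hZ : f (wordZ (Fin.last n)) = wordZ (Fin.last n)) (p : PauliWord n) :
    (restrictEquiv f hX hZ p).extend = f p.extend :=
  extend_restrict (v_last_eq_zero hX hZ p)

end PauliWord

open PauliWord

/-! ### Circuits on the first `n` of `n + 1` wires, and the main induction. -/

theorem Gate.castSucc_act {n : ℕ} (g : Gate n) (p : PauliWord (n + 1)) :
    (g.castSucc.act p).restrict = g.act p.restrict ∧
      (g.castSucc.act p).v (Fin.last n) = p.v (Fin.last n) := by
  cases g with
  | H i =>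
    refine ⟨PauliWord.ext rfl (funext fun j => ?_), ?_⟩
    · simp [Gate.castSucc, Gate.act, restrict, Function.update_apply]
    · simp [Gate.castSucc, Gate.act, (Fin.castSucc_ne_last _).symm]
  | Z i => exact ⟨rfl, rfl⟩
  | CZ i h =>
    refine ⟨PauliWord.ext rfl (funext fun j => ?_), ?_⟩
    · simp [Gate.castSucc, Gate.act, restrict, Function.update_apply, Fin.ext_iff]
    · have h₁ : n ≠ i := by omega
      have h₂ : n ≠ i + 1 := by omega
      simp [Gate.castSucc, Gate.act, Fin.ext_iff, h₁, h₂]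

theorem Circuit.castSucc_act {n : ℕ} (w : Circuit n) (p : PauliWord (n + 1)) :
    (Circuit.act (w.map Gate.castSucc) p).restrict = w.act p.restrict ∧
      (Circuit.act (w.map Gate.castSucc) p).v (Fin.last n) = p.v (Fin.last n) := by
  induction w generalizing p with
  | nil => exact ⟨rfl, rfl⟩
  | cons g w ih =>
    rw [List.map_cons, Circuit.act_cons, Circuit.act_cons, (ih _).1, (ih _).2,
      (g.castSucc_act p).1, (g.castSucc_act p).2]
    exact ⟨rfl, rfl⟩

theorem Circuit.castSucc_act_extend {n : ℕ} (w : Circuit n) (p : PauliWord n) :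
    Circuit.act (w.map Gate.castSucc) p.extend = (w.act p).extend := by
  apply ext_restrict
  · rw [(w.castSucc_act _).1, restrict_extend, restrict_extend]
  · rw [(w.castSucc_act _).2, extend_v_last, extend_v_last]

theorem Circuit.castSucc_act_single {n : ℕ} (w : Circuit n) (a : Letter) :
    Circuit.act (w.map Gate.castSucc) ⟨0, Pi.single (Fin.last n) a⟩ =
      ⟨0, Pi.single (Fin.last n) a⟩ := by
  apply ext_restrict
  · rw [(w.castSucc_act _).1, restrict_single_last, w.act_one]
  · rw [(w.castSucc_act _).2]

theorem NormalBody.step_act {n : ℕ} (C : NormalBody n) (M : XCircuit n) (L : ZCircuit n)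
    (p : PauliWord (n + 1)) :
    (NormalBody.step C M L).circuit.act p =
      Circuit.act (C.circuit.map Gate.castSucc) (M.circuit.act (L.circuit.act p)) := by
  rw [NormalBody.circuit, Circuit.act_append, Circuit.act_append]

/-- Every automorphism of the symbolic Pauli group is conjugation by exactly one normal circuit
without scalar. -/
theorem existsUnique_normalBody {n : ℕ} (φ : PauliWord n ≃* PauliWord n) :
    ∃! C : NormalBody n, ∀ p, C.circuit.act p = φ p := by
  induction n with
  | zero =>
    refine ⟨.nil, fun p => ?_, fun C _ => by cases C; rfl⟩
    -- On no wires the group is `{±1}`; an automorphism fixes `1`, hence also the only other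
    -- element.
    have h01 : ∀ p : PauliWord 0, p = 1 ∨ p ≠ 1 ∧ ∀ q : PauliWord 0, q ≠ 1 → q = p := by
      have h : ∀ s : Fin 2, s = 0 ∨ s ≠ 0 ∧ ∀ t : Fin 2, t ≠ 0 → t = s := by decide
      have heq : ∀ p q : PauliWord 0, p = q ↔ p.s = q.s := fun p q =>
        ⟨congrArg PauliWord.s, fun h => PauliWord.ext h (Subsingleton.elim _ _)⟩
      intro p
      simp only [Ne, heq, one_s]
      exact (h p.s).imp_right fun h => ⟨h.1, fun q hq => h.2 q.s hq⟩
    change p = φ p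
    rcases h01 p with rfl | ⟨hp, h⟩
    · rw [map_one]
    · exact (h _ (by rwa [Ne, map_eq_one_iff φ φ.injective])).symm
  | succ n ih =>
    obtain ⟨a, ha⟩ := φ.surjective (wordZ (Fin.last n))
    obtain ⟨b, hb⟩ := φ.surjective (wordX (Fin.last n))
    have haa : a * a = 1 := φ.injective (by rw [map_mul, ha, map_one, wordZ_mul_self])
    have hbb : b * b = 1 := φ.injective (by rw [map_mul, hb, map_one, wordX_mul_self])
    have hba : b * a ≠ a * b := fun h => wordX_mul_wordZ_ne (Fin.last n) (by
      rw [← ha, ← hb, ← map_mul, h, map_mul])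
    have hav : a.v ≠ 0 := fun h => hba (by rw [mul_eq_mul_iff]; simp [h])
    obtain ⟨L, hL, hLu⟩ := existsUnique_zCircuit a hav haa
    -- Conjugation by `L` preserves anticommutation, and `a` has become `Z` on the top wire.
    have hq : ((L.circuit.act b).v 0).1 = 1 := by
      have h1 : ∀ x : Fin 2, x ≠ 0 → x = 1 := by decide
      refine h1 _ fun h => hba (L.circuit.act_injective ?_)
      rw [Circuit.act_mul, Circuit.act_mul, hL]
      exact (mul_wordZ_comm_iff _ _).2 h
    obtain ⟨M, hM, hMu⟩ := existsUnique_xCircuit _ hq (Circuit.act_mul_self _ hbb)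
    -- What is left of `φ` after undoing `L` and `M`: this is to be realized by `C' ⊗ I`.
    let ψ : PauliWord (n + 1) ≃* PauliWord (n + 1) :=
      (L.circuit.actEquiv.trans M.circuit.actEquiv).symm.trans φ
    have hψ : ∀ p, ψ (M.circuit.act (L.circuit.act p)) = φ p := fun p =>
      congrArg φ ((L.circuit.actEquiv.trans M.circuit.actEquiv).symm_apply_apply p)
    have hψX : ψ (wordX (Fin.last n)) = wordX (Fin.last n) := by rw [← hM, hψ, hb, hM]
    have hψZ : ψ (wordZ (Fin.last n)) = wordZ (Fin.last n) := by
      rw [← M.act_wordZ, ← hL, hψ, ha, hL, M.act_wordZ]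
    obtain ⟨C, hC, hCu⟩ := ih (restrictEquiv ψ hψX hψZ)
    refine ⟨.step C M L, fun p => ?_, ?_⟩
    · have : Circuit.actEquiv (C.circuit.map Gate.castSucc) = ψ := by
        refine mulEquiv_ext (fun r => ?_) ?_ ?_
        · rw [Circuit.actEquiv_apply, Circuit.castSucc_act_extend, hC, extend_restrictEquiv]
        · rw [hψX]
          exact Circuit.castSucc_act_single _ _
        · rw [hψZ]
          exact Circuit.castSucc_act_single _ _
      rw [NormalBody.step_act, ← Circuit.actEquiv_apply, this, hψ]
    · intro B hB
      cases B with
      | step C' M' L' =>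
        simp only [NormalBody.step_act] at hB
        -- Cancel `C' ⊗ I`, which fixes `Z` on the last wire, then `M'`, which produces that `Z`
        -- from `Z` on the top wire.
        obtain rfl : L' = L := by
          refine hLu _ (M'.circuit.act_injective ?_)
          apply Circuit.act_injective (C'.circuit.map Gate.castSucc)
          rw [hB, ha, M'.act_wordZ]
          exact (Circuit.castSucc_act_single _ _).symm
        obtain rfl : M' = M := by
          refine hMu _ ?_
          apply Circuit.act_injective (C'.circuit.map Gate.castSucc)
          rw [hB, hb]
          exact (Circuit.castSucc_act_single _ _).symm
        rw [hCu C' fun r => ?_]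
        apply extend_injective
        rw [← Circuit.castSucc_act_extend, extend_restrictEquiv]
        -- Every Pauli on the first `n` wires is an image under `L'` and `M'`, so `hB` determines
        -- `C'` on all of them.
        obtain ⟨p, hp⟩ := (L'.circuit.actEquiv.trans M'.circuit.actEquiv).surjective r.extend
        change M'.circuit.act (L'.circuit.act p) = r.extend at hp
        rw [← hp, hB, hψ]

/-! ### Normal circuits -/

theorem NormalCircuit.conj_op {n : ℕ} (C : NormalCircuit n) (P : Ortho n) :
    C.op * P * C.op⁻¹ = C.body.circuit.op * P * C.body.circuit.op⁻¹ := by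
  have hn : ∀ V : Ortho n, (-V)⁻¹ = -V⁻¹ := fun V => by
    rw [inv_eq_iff_mul_eq_one]; simp
  unfold NormalCircuit.op
  split_ifs <;> simp [hn]

theorem NormalCircuit.realizes_iff {n : ℕ} (C : NormalCircuit n)
    (φ : pauliGroup n ≃* pauliGroup n) :
    C.Realizes φ ↔
      ∀ p, C.body.circuit.act p = ((opEquiv n).trans (φ.trans (opEquiv n).symm)) p := by
  rw [NormalCircuit.Realizes, (opEquiv n).surjective.forall]
  refine forall_congr' fun p => ?_
  rw [C.conj_op, coe_opEquiv, ← Circuit.op_act, MulEquiv.trans_apply, MulEquiv.trans_apply,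
    (opEquiv n).eq_symm_apply]
  exact (Subtype.ext_iff (a1 := opEquiv n (C.body.circuit.act p))).symm

theorem NormalCircuit.body_eq_iff {n : ℕ} (C D : NormalCircuit n) :
    D.body = C.body ↔ D = C ∨ D = -C := by
  obtain ⟨s, B⟩ := C
  obtain ⟨t, B'⟩ := D
  have h : ∀ s t : Bool, t = s ∨ t = !s := by decide
  constructor
  · rintro rfl
    exact (h s t).imp (fun h => NormalCircuit.ext h rfl) fun h => NormalCircuit.ext h rfl
  · rintro (h | h)
    · exact congrArg NormalCircuit.body h
    · exact (congrArg NormalCircuit.body h :)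

theorem NormalCircuit.op_neg {n : ℕ} (C : NormalCircuit n) : (-C).op = -C.op := by
  obtain ⟨_ | _, B⟩ := C
  · rfl
  · exact (neg_neg _).symm

/-- Guarantees that `C` and `-C` are different operators, so the scalar of a normal form is unique.
-/
theorem ortho_ne_neg {n : ℕ} (U : Ortho n) : U ≠ -U := by
  intro h
  have h1 : (1 : Ortho n) = -1 := by
    rw [← mul_inv_cancel U, ← neg_mul, ← h]
  rw [← PauliWord.op_one, ← PauliWord.op_neg] at h1
  exact absurd (congrArg PauliWord.s (op_injective h1)) (by rw [neg_s, one_s]; decide)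

theorem exists_normalCircuit_realizes {n : ℕ} (φ : pauliGroup n ≃* pauliGroup n) :
    ∃ C : NormalCircuit n, C.Realizes φ ∧
      ∀ D : NormalCircuit n, D.Realizes φ ↔ D = C ∨ D = -C := by
  obtain ⟨B, hB, hBu⟩ := existsUnique_normalBody ((opEquiv n).trans (φ.trans (opEquiv n).symm))
  refine ⟨⟨false, B⟩, (NormalCircuit.realizes_iff _ φ).2 hB, fun D => ?_⟩
  rw [← NormalCircuit.body_eq_iff, NormalCircuit.realizes_iff]
  exact ⟨hBu _, fun h => h ▸ hB⟩

/-! ### Clifford operators, their normal forms, and generation by gates. -/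

theorem Circuit.op_mem {n : ℕ} (w : Circuit n) : w.op ∈ cliffordGroup n := by
  refine Subgroup.mem_normalizer_iff.2 fun P => ⟨fun hP => ?_, fun hP => ?_⟩
  · obtain ⟨p, rfl⟩ := exists_op_eq hP
    rw [← w.op_act]
    exact PauliWord.op_mem _
  · obtain ⟨q, hq⟩ := exists_op_eq hP
    -- Surjectivity, obtained from finiteness, gives the reverse inclusion needed for the
    -- normalizer.
    obtain ⟨p, rfl⟩ := w.actEquiv.surjective q
    rw [w.actEquiv_apply, w.op_act] at hq
    rw [← mul_left_cancel (mul_right_cancel hq)]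
    exact PauliWord.op_mem p

theorem neg_one_mem_cliffordGroup (n : ℕ) : (-1 : Ortho n) ∈ cliffordGroup n := by
  have hn : (-1 : Ortho n)⁻¹ = -1 := by rw [inv_eq_iff_mul_eq_one]; simp
  refine Subgroup.mem_normalizer_iff.2 fun P => ?_
  simp [hn]

theorem NormalCircuit.op_mem {n : ℕ} (C : NormalCircuit n) : C.op ∈ cliffordGroup n := by
  unfold NormalCircuit.op
  split_ifs
  · rw [← neg_one_mul (Circuit.op _)]
    exact mul_mem (neg_one_mem_cliffordGroup n) (Circuit.op_mem _)
  · exact Circuit.op_mem _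

/-- Conjugation by a Clifford operator, as an automorphism of the Pauli group. -/
def conjPauli {n : ℕ} (U : Ortho n) (hU : U ∈ cliffordGroup n) : pauliGroup n ≃* pauliGroup n where
  toFun P := ⟨U * P * U⁻¹, (Subgroup.mem_normalizer_iff.1 hU P).1 P.2⟩
  invFun P := ⟨U⁻¹ * P * U, (Subgroup.mem_normalizer_iff.1 hU _).2 (by
    have : U * (U⁻¹ * P * U) * U⁻¹ = (P : Ortho n) := by group
    rw [this]
    exact P.2)⟩
  left_inv P := Subtype.ext (by group)
  right_inv P := Subtype.ext (by group)
  map_mul' P Q := Subtype.ext (by simp only [Subgroup.coe_mul]; group)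

theorem eq_or_eq_neg_of_conj_eq {n : ℕ} (U V : Ortho n)
    (h : ∀ p : PauliWord n, U * p.op * U⁻¹ = V * p.op * V⁻¹) : U = V ∨ U = -V := by
  have h1 : ∀ p : PauliWord n, V⁻¹ * U * p.op = p.op * (V⁻¹ * U) := by
    intro p
    calc V⁻¹ * U * p.op = V⁻¹ * (U * p.op * U⁻¹) * U := by group
      -- Replacing conjugation by `U` with conjugation by `V` makes `V⁻¹ * U` commute with every
      -- Pauli.
      _ = p.op * (V⁻¹ * U) := by rw [h]; group
  rcases eq_one_or_eq_neg_one_of_commute _ h1 with h2 | h2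
  · exact Or.inl (inv_mul_eq_one.1 h2).symm
  · right
    rw [inv_mul_eq_iff_eq_mul] at h2
    simpa using h2

theorem existsUnique_normalCircuit {n : ℕ} {U : Ortho n} (hU : U ∈ cliffordGroup n) :
    ∃! C : NormalCircuit n, C.op = U := by
  obtain ⟨C, hC, hCu⟩ := exists_normalCircuit_realizes (conjPauli U hU)
  have hop : C.op = U ∨ C.op = -U := eq_or_eq_neg_of_conj_eq _ _ fun p => hC (opEquiv n p)
  have hreal : ∀ D : NormalCircuit n, D.op = U → D = C ∨ D = -C := by
    rintro D rfl
    exact (hCu D).1 fun P => rfl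
  rcases hop with hop | hop
  · refine ⟨C, hop, fun D hD => (hreal D hD).resolve_right ?_⟩
    rintro rfl
    exact ortho_ne_neg C.op (hop.trans (hD.symm.trans C.op_neg))
  · refine ⟨-C, by simp [C.op_neg, hop], fun D hD => (hreal D hD).resolve_left ?_⟩
    rintro rfl
    exact ortho_ne_neg U (hD.symm.trans hop)

theorem closure_gates (n : ℕ) :
    Subgroup.closure ({-1} ∪ Set.range (Gate.op (n := n))) = cliffordGroup n := by
  apply le_antisymm
  · rw [Subgroup.closure_le]
    rintro _ (rfl | ⟨g, rfl⟩)
    · exact neg_one_mem_cliffordGroup n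
    · simpa [Circuit.op] using Circuit.op_mem [g]
  · intro U hU
    obtain ⟨C, rfl, -⟩ := existsUnique_normalCircuit hU
    have hw : ∀ w : Circuit n,
        w.op ∈ Subgroup.closure ({-1} ∪ Set.range (Gate.op (n := n))) := by
      intro w
      induction w with
      | nil =>
        rw [Circuit.op]
        exact one_mem _
      | cons g w ih => exact mul_mem ih (Subgroup.subset_closure (Set.mem_union_right _ ⟨g, rfl⟩))
    unfold NormalCircuit.op
    split_ifs
    · rw [← neg_one_mul (Circuit.op _)]
      exact mul_mem (Subgroup.subset_closure (Set.mem_union_left _ rfl)) (hw _)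
    · exact hw _

end

end RealClifford

theorem proposition4p15 (n : ℕ) :
    -- every automorphism is realized by a normal circuit, unique up to the scalar `±1`
    (∀ φ : RealClifford.pauliGroup n ≃* RealClifford.pauliGroup n,
      ∃ C : RealClifford.NormalCircuit n, C.Realizes φ ∧
        ∀ D : RealClifford.NormalCircuit n, D.Realizes φ ↔ D = C ∨ D = -C) ∧
    -- the operators of normal circuits are Clifford operators
    (∀ C : RealClifford.NormalCircuit n, C.op ∈ RealClifford.cliffordGroup n) ∧
    -- every Clifford operator has a unique normal form
    (∀ U ∈ RealClifford.cliffordGroup n, ∃! C : RealClifford.NormalCircuit n, C.op = U) ∧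
    -- the Clifford group is generated by `-1`, `H`, `Z` and `CZ`
    Subgroup.closure ({-1} ∪ Set.range (RealClifford.Gate.op (n := n))) =
      RealClifford.cliffordGroup n := by
  exact ⟨RealClifford.exists_normalCircuit_realizes, fun C => C.op_mem,
    fun _ hU => RealClifford.existsUnique_normalCircuit hU, RealClifford.closure_gates n⟩
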